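/- Let $d\ge 1$, let $\Omega\subset\mathbb{R}^d$ be a bounded Lipschitz domain, $T>0$, $I=(0,T)$, $s\in(0,1)$, $p\in(0,1)$, $\alpha,\beta,\gamma>0$, and $U:=L^2(I\times\Omega)$. Set $c_{d,s}:=\frac{s2^{2s}\Gamma(s+d/2)}{\pi^{d/2}\Gamma(1-s)}$, and for an open set $D\subset\mathbb{R}^d$ let $H^s(D)$ be the space of all $w\in L^2(D)$ with $$\|w\|_{H^s(D)}^2:=\int_D|w|^2\,dx+\frac{c_{d,s}}{2}\int_D\int_D\frac{|w(x)-w(y)|^2}{|x-y|^{d+2s}}\,dy\,dx<\infty .$$ Let $W$ be one of the following spaces: - $H^s(\Omega)$ with its norm; - $H^s_0(\Omega)$, the closure of $C_c^\infty(\Omega)$ in $H^s(\Omega)$, with the norm of $H^s(\Omega)$; - $\tilde H^s(\Omega)$, the space of functions on $\Omega$ whose extension by zero belongs to $H^s(\mathbb{R}^d)$, with the $H^s(\mathbb{R}^d)$-norm of that extension; - the spectral space $\mathbb{H}^s(\Omega)$ of all $w\in L^2(\Omega)$ with $\|w\|_{\mathbb{H}^s(\Omega)}^2:=\sum_{n}\lambda_n^s\left(\int_\Omega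 w\phi_n\,dx\right)^2<\infty$, where $(\phi_n)$ is an orthonormal basis of $L^2(\Omega)$ consisting of eigenfunctions of the Laplacian $-\Delta$ with zero Dirichlet boundary conditions, with eigenvalues $\lambda_n$. Let $f:U\to\mathbb{R}$ be weakly lower semicontinuous, bounded from below by an affine function (there are $g\in U^*$ and $c\in\mathbb{R}$ with $f(u)\ge g(u)+c$ for all $u\in U$), and continuously Fréchet differentiable. Put $$K:=\{(u,w)\in U\times W:\ |u(t,x)|\le w(x)\ \text{for a.a. }(t,x)\in I\times\Omega\},$$ $$\Phi(u,w):=f(u)+\frac{\alpha}{2}\|u\|_U^2+\frac{\beta}{2}\|w\|_W^2+\gamma\int_\Omega|w|^p\,dx .$$ Let $(\bar u,\bar w)\in K$ be a local solution of the problem of minimizing $\Phi$ over $K$, i.e., there is $\rho>0$ such that $\Phi(\bar u,\bar w)\le\Phi(u,w)$ for all $(u,w)\in K$ with $\|u-\bar u\|_U\le\rho$ and $\|w-\bar w\|_W\le\rho$. Suppose that $d\le 2s$, or that $d>2s$ and $\frac{2d}{d-2s}>4$. Then $\bar w\in L^\infty(\Omega)$ and $\bar u\in L^\infty(I\times\Omega)$.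 -/

import Mathlib

open MeasureTheory Set Filter Topology
open scoped ENNReal ContDiff

namespace SparseFrac

noncomputable section

/-- The Euclidean space `ℝ^d`. -/
abbrev E (d : ℕ) : Type := EuclideanSpace ℝ (Fin d)

/-- A bounded Lipschitz domain: a bounded, open, nonempty connected set which near each of its
boundary points is, in suitable Cartesian coordinates `(y, t)` (with `y` orthogonal to a unit
vector `ν` and `t` the coordinate along `ν`), the region strictly above the graph of a Lipschitz
function. -/
structure IsBoundedLipschitzDomain {d : ℕ} (Ω : Set (E d)) : Prop where
  isOpen : IsOpen Ω
  isConnected : IsConnected Ω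
  isBounded : Bornology.IsBounded Ω
  lipschitz_boundary : ∀ x₀ ∈ frontier Ω, ∃ (ν : E d) (g : E d → ℝ) (L : NNReal) (r : ℝ),
    ‖ν‖ = 1 ∧ 0 < r ∧ LipschitzOnWith L g {y | inner ℝ ν y = 0} ∧
      ∀ (y : E d) (t : ℝ), inner ℝ ν y = 0 → y + t • ν ∈ Metric.ball x₀ r →
        (y + t • ν ∈ Ω ↔ g y < t)

/-- `C_c^∞(Ω)`. -/
def IsTestFunction {d : ℕ} (Ω : Set (E d)) (ψ : E d → ℝ) : Prop :=
  ContDiff ℝ ∞ ψ ∧ HasCompactSupport ψ ∧ tsupport ψ ⊆ Ω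

/-! ### The spaces `H^s`, `H^s_0`, `H̃^s` -/

/-- The constant `c_{d,s} = s 2^{2s} Γ(s + d/2) / (π^{d/2} Γ(1 - s))`. -/
def fracConst (d : ℕ) (s : ℝ) : ℝ :=
  s * (2 : ℝ) ^ (2 * s) * Real.Gamma (s + d / 2) /
    (Real.pi ^ ((d : ℝ) / 2) * Real.Gamma (1 - s))

/-- Membership in `H^s(Ω)`. -/
def MemHs {d : ℕ} (s : ℝ) (Ω : Set (E d)) (w : E d → ℝ) : Prop :=
  MemLp w 2 (volume.restrict Ω) ∧
    MemLp (fun z : E d × E d => |w z.1 - w z.2| / ‖z.1 - z.2‖ ^ ((d : ℝ) / 2 + s)) 2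
      ((volume.restrict Ω).prod (volume.restrict Ω))

/-- The square of the norm of `H^s(Ω)`. -/
def hsNormSq {d : ℕ} (s : ℝ) (Ω : Set (E d)) (w : E d → ℝ) : ℝ :=
  (∫ x in Ω, |w x| ^ 2) +
    fracConst d s / 2 * ∫ x in Ω, ∫ y in Ω, |w x - w y| ^ 2 / ‖x - y‖ ^ ((d : ℝ) + 2 * s)

/-- Membership in `H^s_0(Ω)`, the closure of `C_c^∞(Ω)` in `H^s(Ω)`. -/
def MemHs0 {d : ℕ} (s : ℝ) (Ω : Set (E d)) (w : E d → ℝ) : Prop :=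
  MemHs s Ω w ∧ ∀ ε > 0, ∃ ψ, IsTestFunction Ω ψ ∧ √(hsNormSq s Ω (fun x => w x - ψ x)) < ε

/-- Membership in `H̃^s(Ω)`: the extension of `w` by zero belongs to `H^s(ℝ^d)`. -/
def MemHsTilde {d : ℕ} (s : ℝ) (Ω : Set (E d)) (w : E d → ℝ) : Prop :=
  MemHs s univ (Ω.indicator w)

/-! ### The spectral space -/

/-- `w ∈ H^1_0(Ω)` with gradient `G`: the pair `(w, G)` is the limit in `L²(Ω) × L²(Ω)^d` of
pairs `(ψ, ∇ψ)` with `ψ ∈ C_c^∞(Ω)`. -/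
def HasH10Gradient {d : ℕ} (Ω : Set (E d)) (w : E d → ℝ) (G : E d → E d) : Prop :=
  MemLp w 2 (volume.restrict Ω) ∧ MemLp G 2 (volume.restrict Ω) ∧
    ∀ ε : ℝ≥0∞, 0 < ε → ∃ ψ, IsTestFunction Ω ψ ∧
      eLpNorm (fun x => w x - ψ x) 2 (volume.restrict Ω) < ε ∧
      eLpNorm (fun x => G x - gradient ψ x) 2 (volume.restrict Ω) < ε

/-- `-Δ φ = lam φ` in `Ω` with zero Dirichlet boundary conditions, in the weak sense:
`φ ∈ H^1_0(Ω)` and `∫ ∇φ · ∇ψ = lam ∫ φ ψ` for all `ψ ∈ C_c^∞(Ω)`. -/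
def IsDirichletEigen {d : ℕ} (Ω : Set (E d)) (φ : E d → ℝ) (lam : ℝ) : Prop :=
  ∃ G : E d → E d, HasH10Gradient Ω φ G ∧
    ∀ ψ, IsTestFunction Ω ψ →
      ∫ x in Ω, inner ℝ (G x) (gradient ψ x) = lam * ∫ x in Ω, φ x * ψ x

/-- An orthonormal basis of `L²(Ω)` made of eigenfunctions of the Dirichlet Laplacian, with the
corresponding eigenvalues (repeated according to multiplicity). -/
structure DirichletEigenbasis {d : ℕ} (Ω : Set (E d)) where
  φ : HilbertBasis ℕ ℝ (Lp ℝ 2 (volume.restrict Ω))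
  lam : ℕ → ℝ
  isEigen : ∀ n, IsDirichletEigen Ω (φ n) (lam n)

/-- The coefficient `w_n = ∫_Ω w φ_n`. -/
def DirichletEigenbasis.coeff {d : ℕ} {Ω : Set (E d)} (B : DirichletEigenbasis Ω)
    (w : E d → ℝ) (n : ℕ) : ℝ :=
  ∫ x in Ω, w x * B.φ n x

/-- Membership in the spectral space `ℍ^s(Ω)`. -/
def MemSpectral {d : ℕ} (s : ℝ) {Ω : Set (E d)} (B : DirichletEigenbasis Ω)
    (w : E d → ℝ) : Prop :=
  MemLp w 2 (volume.restrict Ω) ∧ Summable fun n => B.lam n ^ s * B.coeff w n ^ 2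

/-- The square of the norm of `ℍ^s(Ω)`. -/
def spectralNormSq {d : ℕ} (s : ℝ) {Ω : Set (E d)} (B : DirichletEigenbasis Ω)
    (w : E d → ℝ) : ℝ :=
  ∑' n, B.lam n ^ s * B.coeff w n ^ 2

/-! ### The space `W` -/

/-- The four admissible choices `H^s(Ω)`, `H^s_0(Ω)`, `H̃^s(Ω)`, `ℍ^s(Ω)` of the space `W`. The
spectral space is written in terms of an eigenbasis of the Dirichlet Laplacian. -/
inductive FracSpace {d : ℕ} (Ω : Set (E d)) where
  | full : FracSpace Ω
  | zero : FracSpace Ω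
  | tilde : FracSpace Ω
  | spectral (B : DirichletEigenbasis Ω) : FracSpace Ω

/-- Membership in `W`. -/
def FracSpace.Mem {d : ℕ} {Ω : Set (E d)} (W : FracSpace Ω) (s : ℝ) (w : E d → ℝ) : Prop :=
  match W with
  | .full => MemHs s Ω w
  | .zero => MemHs0 s Ω w
  | .tilde => MemHsTilde s Ω w
  | .spectral B => MemSpectral s B w

/-- The square of the norm of `W`. -/
def FracSpace.normSq {d : ℕ} {Ω : Set (E d)} (W : FracSpace Ω) (s : ℝ) (w : E d → ℝ) : ℝ :=
  match W with
  | .full => hsNormSq s Ω w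
  | .zero => hsNormSq s Ω w
  | .tilde => hsNormSq s univ (Ω.indicator w)
  | .spectral B => spectralNormSq s B w

/-- The norm of `W`. -/
def FracSpace.norm {d : ℕ} {Ω : Set (E d)} (W : FracSpace Ω) (s : ℝ) (w : E d → ℝ) : ℝ :=
  √(W.normSq s w)

/-! ### The optimization problem -/

/-- Lebesgue measure on the cylinder `I × Ω`, `I = (0, T)`. -/
abbrev cylMeasure {d : ℕ} (T : ℝ) (Ω : Set (E d)) : Measure (ℝ × E d) :=
  (volume.restrict (Ioo 0 T)).prod (volume.restrict Ω)

/-- `U = L²(I × Ω)`. -/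
abbrev U {d : ℕ} (T : ℝ) (Ω : Set (E d)) : Type := Lp ℝ 2 (cylMeasure T Ω)

/-- Weak (sequential) lower semicontinuity. -/
def WeaklyLSC {X : Type*} [NormedAddCommGroup X] [NormedSpace ℝ X] (f : X → ℝ) : Prop :=
  ∀ (u : ℕ → X) (v : X), (∀ l : X →L[ℝ] ℝ, Tendsto (fun n => l (u n)) atTop (𝓝 (l v))) →
    ∀ c < f v, ∀ᶠ n in atTop, c < f (u n)

/-- The admissible set `K`: `w ∈ W` and `|u(t,x)| ≤ w(x)` for almost all `(t,x) ∈ I × Ω`. -/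
def Admissible {d : ℕ} (T s : ℝ) {Ω : Set (E d)} (W : FracSpace Ω)
    (u : U T Ω) (w : Lp ℝ 2 (volume.restrict Ω)) : Prop :=
  W.Mem s w ∧ ∀ᵐ z ∂(cylMeasure T Ω), |u z| ≤ w z.2

/-- The objective `f(u) + α/2 ‖u‖_U² + β/2 ‖w‖_W² + γ ∫_Ω |w|^p`. -/
def objective {d : ℕ} (T s p α β γ : ℝ) {Ω : Set (E d)} (W : FracSpace Ω) (f : U T Ω → ℝ)
    (u : U T Ω) (w : Lp ℝ 2 (volume.restrict Ω)) : ℝ :=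
  f u + α / 2 * ‖u‖ ^ 2 + β / 2 * W.normSq s w + γ * ∫ x in Ω, |w x| ^ p

/-- `(u, w)` is a local solution of the problem of minimizing the objective over `K`. -/
def IsLocalSolution {d : ℕ} (T s p α β γ : ℝ) {Ω : Set (E d)} (W : FracSpace Ω)
    (f : U T Ω → ℝ) (u : U T Ω) (w : Lp ℝ 2 (volume.restrict Ω)) : Prop :=
  Admissible T s W u w ∧ ∃ ρ > 0, ∀ (u' : U T Ω) (w' : Lp ℝ 2 (volume.restrict Ω)),
    Admissible T s W u' w' → ‖u' - u‖ ≤ ρ → W.norm s (fun x => w' x - w x) ≤ ρ →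
      objective T s p α β γ W f u w ≤ objective T s p α β γ W f u' w'

end

end SparseFrac

/-! ### The level-set iteration. -/

namespace SparseFrac

/-! Write `v = (w - k)^+` for the excess over a level `k > 0`. Local minimality is tested with `w' =
w - t v` and with `u'`, the clipping of `u` to `[-w', w']`. This pair is admissible. Neither the
`α`-term nor the nonconvex `γ`-term increases, because `|u'| ≤ |u|` and `0 ≤ w' ≤ w`. The squared
`W`-norm drops by at least `(2t - t²) Q`, where `Q` is the squared `W`-norm of `v`. Since `|u' - u|
≤ t v` and `f` is Lipschitz near `u`, `f` rises by at most a constant times `t ‖v‖_{L²}`. Dividing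
by `t` gives `Q ≤ L ‖v‖_{L²}` with `L` independent of `k` (`IsLocalSolution.exists_mul_le`).

Against this stands a Faber–Krahn inequality `‖v‖_{L²}² ≤ C a(k)^{2s/d} Q`, where `a(k)` is the
measure of `{w > k}`, assumed small. Together they give `‖v‖_{L²} ≤ C L a(k)^{2s/d}`, and Chebyshev
turns this into `(l - k)² a(l) ≤ (C L)² a(k)^{4s/d}`. The exponent condition says exactly `d < 4s`,
so the decay is superlinear and Stampacchia's lemma gives `a(k) = 0` for some `k`. The bound on `w`
passes to `u` through `|u| ≤ w`.

What depends on the space is collected in `FracSpace.HasTruncation`. For the Gagliardo norms the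
energy drop is a pointwise inequality for difference quotients, and Faber–Krahn follows from measure
density: Lipschitz domains contain corkscrew balls, and for zero extensions the domain is the whole
space. In `H^s_0` one also needs truncation to preserve the closure of test functions, which is done
with a smooth substitute for `min`.

For the spectral norm, `λ^s` is a positive superposition of the Yosida weights `μλ/(λ + μ)`. Each
Yosida form is the infimum of `μ‖x - ψ‖² + ‖∇ψ‖²` over test functions `ψ`, hence decreases under
truncation, and so does the fractional form (`IsEigenGraph.rpow_sum_le`). The same infimum yields an
`L²` translation estimate, from which Faber–Krahn follows by averaging over a ball. -/

/-- Stampacchia's lemma: a nonnegative antitone function with superlinear decay of its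
level differences vanishes at a finite level. -/
theorem exists_eq_zero_of_sq_sub_mul_le {a : ℝ → ℝ} (ha : ∀ k, 0 ≤ a k) (hanti : Antitone a)
    {K σ k₀ : ℝ} (hK : 0 ≤ K) (hσ : 1 < σ)
    (h : ∀ k l, k₀ ≤ k → k < l → (l - k) ^ 2 * a l ≤ K * a k ^ σ) :
    ∃ k, k₀ ≤ k ∧ a k = 0 := by
  rcases (ha k₀).eq_or_lt with h0 | h0
  · exact ⟨k₀, le_rfl, h0.symm⟩
  have hσ' : 0 < σ - 1 := by linarith
  -- The ratio `δ` is chosen so that the gain `δ^{(σ-1)j}` cancels the factor `4^j` lost through the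
  -- shrinking level gaps.
  obtain ⟨δ, hδdef⟩ : ∃ δ : ℝ, δ = (1 / 4 : ℝ) ^ (1 / (σ - 1)) := ⟨_, rfl⟩
  have hδ0 : 0 < δ := by rw [hδdef]; positivity
  have hδ1 : δ < 1 := by
    rw [hδdef]; exact Real.rpow_lt_one (by norm_num) (by norm_num) (by positivity)
  have hδσ : δ ^ (σ - 1) = 1 / 4 := by
    rw [hδdef, ← Real.rpow_mul (by norm_num), one_div_mul_cancel hσ'.ne', Real.rpow_one]
  have hM : 0 ≤ 4 * K * a k₀ ^ (σ - 1) / δ := by positivity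
  -- `D` is the total climb above `k₀`, just large enough to close the induction; the `+ 1` keeps it
  -- positive even when `K = 0`.
  obtain ⟨D, hD⟩ : ∃ D : ℝ, D = √(4 * K * a k₀ ^ (σ - 1) / δ) + 1 := ⟨_, rfl⟩
  have hD0 : 0 < D := by rw [hD]; positivity
  have hD2 : 4 * K * a k₀ ^ (σ - 1) ≤ D ^ 2 * δ := by
    rw [← div_le_iff₀ hδ0, hD]
    nlinarith [Real.sq_sqrt hM, Real.sqrt_nonneg (4 * K * a k₀ ^ (σ - 1) / δ)]
  -- Geometric decay along the levels `k₀ + D (1 - 2^{-j})`, which increase to `k₀ + D`.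
  have key : ∀ j : ℕ, a (k₀ + D * (1 - (1 / 2) ^ j)) ≤ a k₀ * δ ^ j := by
    intro j
    induction j with
    | zero => simp
    | succ j ih =>
      have hp : (0 : ℝ) < (1 / 2) ^ j := by positivity
      have hp1 : ((1 : ℝ) / 2) ^ j ≤ 1 := pow_le_one₀ (by norm_num) (by norm_num)
      have h1 := h (k₀ + D * (1 - (1 / 2) ^ j)) (k₀ + D * (1 - (1 / 2) ^ (j + 1)))
        (by nlinarith [mul_nonneg hD0.le (sub_nonneg.2 hp1)])
        (by rw [pow_succ]; nlinarith [mul_pos hD0 hp])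
      have h2 : a (k₀ + D * (1 - (1 / 2) ^ j)) ^ σ ≤ (a k₀ * δ ^ j) ^ σ :=
        Real.rpow_le_rpow (ha _) ih (by linarith)
      have h3 : (a k₀ * δ ^ j) ^ σ = a k₀ ^ (σ - 1) * a k₀ * δ ^ j * (1 / 4) ^ j := by
        have hz : 0 < a k₀ * δ ^ j := by positivity
        have : σ = (σ - 1) + 1 := by ring
        rw [this, Real.rpow_add hz, Real.rpow_one, Real.mul_rpow h0.le (by positivity),
          ← Real.rpow_natCast δ j, ← Real.rpow_mul hδ0.le, mul_comm (j : ℝ),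
          Real.rpow_mul hδ0.le, hδσ]
        simp only [Real.rpow_natCast, add_sub_cancel_right]
        ring
      have h4 : (k₀ + D * (1 - (1 / 2) ^ (j + 1)) - (k₀ + D * (1 - (1 / 2) ^ j))) ^ 2
          = D ^ 2 / 4 * (1 / 4) ^ j := by
        have : ((1 : ℝ) / 4) ^ j = ((1 / 2) ^ j) ^ 2 := by
          rw [← pow_mul, mul_comm, pow_mul]; norm_num
        rw [this, pow_succ]; ring
      rw [h4] at h1
      have hq : (0 : ℝ) < (1 / 4) ^ j := by positivity
      have h5 : D ^ 2 / 4 * (1 / 4) ^ j * a (k₀ + D * (1 - (1 / 2) ^ (j + 1)))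
          ≤ K * (a k₀ ^ (σ - 1) * a k₀ * δ ^ j * (1 / 4) ^ j) :=
        h1.trans (h3 ▸ mul_le_mul_of_nonneg_left h2 hK)
      have h6 : D ^ 2 * a (k₀ + D * (1 - (1 / 2) ^ (j + 1))) ≤ D ^ 2 * (a k₀ * δ ^ (j + 1)) := by
        have h7 : 4 * K * a k₀ ^ (σ - 1) * (a k₀ * δ ^ j) ≤ D ^ 2 * δ * (a k₀ * δ ^ j) :=
          mul_le_mul_of_nonneg_right hD2 (by positivity)
        refine le_of_mul_le_mul_right ?_ hq
        have h8 := mul_le_mul_of_nonneg_right h7 hq.le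
        rw [pow_succ δ j]
        linarith
      exact le_of_mul_le_mul_left h6 (by positivity)
  refine ⟨k₀ + D, by linarith, le_antisymm ?_ (ha _)⟩
  have hlim : Tendsto (fun j : ℕ => a k₀ * δ ^ j) atTop (𝓝 (a k₀ * 0)) :=
    (tendsto_pow_atTop_nhds_zero_of_lt_one hδ0.le hδ1).const_mul _
  rw [mul_zero] at hlim
  refine ge_of_tendsto' hlim fun j => (hanti ?_).trans (key j)
  have : (0 : ℝ) < (1 / 2) ^ j := by positivity
  nlinarith [mul_pos hD0 this]

/-! ### A smooth truncation -/

/-- A smooth approximation of `a ↦ min a k` vanishing at `0`. -/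
noncomputable def smoothMin (k ε a : ℝ) : ℝ :=
  (a + k - √((a - k) ^ 2 + ε ^ 2)) / 2 - (k - √(k ^ 2 + ε ^ 2)) / 2

@[simp] theorem smoothMin_zero (k ε : ℝ) : smoothMin k ε 0 = 0 := by
  simp [smoothMin]

theorem contDiff_smoothMin (k : ℝ) {ε : ℝ} (hε : 0 < ε) : ContDiff ℝ ∞ (smoothMin k ε) := by
  unfold smoothMin
  refine ContDiff.sub (ContDiff.div_const (ContDiff.sub (by fun_prop) ?_) _) (by fun_prop)
  exact ContDiff.sqrt (by fun_prop) fun a => by positivity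

/-- `√(a² + ε²)` is the Euclidean norm of `(a, ε)`, so this is the reverse triangle inequality. -/
theorem abs_sqrt_sq_add_sub_le (ε a b : ℝ) :
    |√(a ^ 2 + ε ^ 2) - √(b ^ 2 + ε ^ 2)| ≤ |a - b| := by
  have h : ∀ a b : ℝ, √(a ^ 2 + ε ^ 2) ≤ √(b ^ 2 + ε ^ 2) + |a - b| := by
    intro a b
    refine Real.sqrt_le_iff.2 ⟨by positivity, ?_⟩
    have h1 : |b| ≤ √(b ^ 2 + ε ^ 2) := Real.le_sqrt_of_sq_le (by rw [sq_abs]; nlinarith)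
    have h2 := Real.sq_sqrt (show 0 ≤ b ^ 2 + ε ^ 2 by positivity)
    have h3 : (a - b) * b ≤ |a - b| * |b| := by rw [← abs_mul]; exact le_abs_self _
    nlinarith [mul_le_mul_of_nonneg_left h1 (abs_nonneg (a - b)), sq_abs (a - b)]
  rw [abs_le]
  constructor
  · have := h b a; rw [abs_sub_comm] at this; linarith
  · have := h a b; linarith

theorem abs_smoothMin_sub_le (k ε a b : ℝ) : |smoothMin k ε a - smoothMin k ε b| ≤ |a - b| := by
  have h := abs_le.1 (abs_sqrt_sq_add_sub_le ε (a - k) (b - k))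
  have h1 : a - k - (b - k) = a - b := by ring
  rw [h1] at h
  have h2 := neg_abs_le (a - b)
  have h3 := le_abs_self (a - b)
  unfold smoothMin
  rw [abs_le]
  constructor <;> linarith

/-- `min a k = (a + k - |a - k|)/2`, and `√(x² + ε²)` lies between `|x|` and `|x| + ε`; the
smoothing and the normalization at `0` each cost at most `ε/2`. -/
theorem abs_smoothMin_sub_min_le {k ε : ℝ} (hk : 0 ≤ k) (hε : 0 ≤ ε) (a : ℝ) :
    |smoothMin k ε a - min a k| ≤ ε := by
  have h : ∀ x : ℝ, |x| ≤ √(x ^ 2 + ε ^ 2) ∧ √(x ^ 2 + ε ^ 2) ≤ |x| + ε := fun x =>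
    ⟨Real.le_sqrt_of_sq_le (by rw [sq_abs]; nlinarith),
      Real.sqrt_le_iff.2 ⟨by positivity, by nlinarith [sq_abs x, abs_nonneg x]⟩⟩
  have h1 := h k
  have h2 := h (a - k)
  rw [abs_of_nonneg hk] at h1
  have h3 : min a k = (a + k - |a - k|) / 2 := by
    rcases le_total a k with h | h
    · rw [min_eq_left h, abs_of_nonpos (by linarith)]; ring
    · rw [min_eq_right h, abs_of_nonneg (by linarith)]; ring
  rw [h3]
  unfold smoothMin
  rw [abs_le]
  constructor <;> linarith [h1.1, h1.2, h2.1, h2.2]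

theorem abs_deriv_smoothMin_le (k ε a : ℝ) : |deriv (smoothMin k ε) a| ≤ 1 := by
  have : LipschitzWith 1 (smoothMin k ε) := LipschitzWith.of_dist_le_mul fun x y => by
    simpa [Real.dist_eq] using abs_smoothMin_sub_le k ε x y
  simpa using norm_deriv_le_of_lipschitz (x₀ := a) this

/-! ### Test functions -/

theorem IsTestFunction.smoothMin_comp {d : ℕ} {Ω : Set (E d)} {ψ : E d → ℝ}
    (hψ : IsTestFunction Ω ψ) (k : ℝ) {ε : ℝ} (hε : 0 < ε) :
    IsTestFunction Ω (fun x => smoothMin k ε (ψ x)) :=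
  ⟨(contDiff_smoothMin k hε).comp hψ.1, hψ.2.1.comp_left (smoothMin_zero k ε),
    (tsupport_comp_subset (smoothMin_zero k ε) ψ).trans hψ.2.2⟩

theorem norm_gradient_smoothMin_comp_le {d : ℕ} {ψ : E d → ℝ} (hψ : Differentiable ℝ ψ)
    (k : ℝ) {ε : ℝ} (hε : 0 < ε) (x : E d) :
    ‖gradient (fun x => smoothMin k ε (ψ x)) x‖ ≤ ‖gradient ψ x‖ := by
  have h1 : fderiv ℝ (fun x => smoothMin k ε (ψ x)) x
      = deriv (smoothMin k ε) (ψ x) • fderiv ℝ ψ x :=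
    (((contDiff_smoothMin k hε).differentiable (by simp) (ψ x)).hasDerivAt.comp_hasFDerivAt x
      (hψ x).hasFDerivAt).fderiv
  simp only [gradient, LinearIsometryEquiv.norm_map, h1, norm_smul, Real.norm_eq_abs]
  exact mul_le_of_le_one_left (norm_nonneg _) (abs_deriv_smoothMin_le _ _ _)

end SparseFrac

namespace SparseFrac

/-! ### Measure density -/

/-- The measure density condition `c r^d ≤ |D ∩ B(x, r)|` for `x ∈ D` and `r ≤ r₀`. -/
def HasMeasureDensity {d : ℕ} (D : Set (E d)) (c r₀ : ℝ) : Prop :=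
  0 < c ∧ 0 < r₀ ∧ ∀ x ∈ D, ∀ r, 0 < r → r ≤ r₀ →
    ENNReal.ofReal (c * r ^ d) ≤ volume (D ∩ Metric.ball x r)

/-- Every point of `t ∩ Ω` is the vertex of an interior corkscrew of proportion `η`. -/
def HasCorkscrews {d : ℕ} (Ω t : Set (E d)) : Prop :=
  ∃ η r₀ : ℝ, 0 < η ∧ 0 < r₀ ∧ ∀ x ∈ t ∩ Ω, ∀ r, 0 < r → r ≤ r₀ →
    ∃ z, Metric.ball z (η * r) ⊆ Ω ∩ Metric.ball x r

theorem HasCorkscrews.mono {d : ℕ} {Ω t t' : Set (E d)} (h : HasCorkscrews Ω t') (ht : t ⊆ t') :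
    HasCorkscrews Ω t := by
  obtain ⟨η, r₀, hη, hr₀, H⟩ := h
  exact ⟨η, r₀, hη, hr₀, fun x hx => H x ⟨ht hx.1, hx.2⟩⟩

theorem HasCorkscrews.union {d : ℕ} {Ω t t' : Set (E d)} (h : HasCorkscrews Ω t)
    (h' : HasCorkscrews Ω t') : HasCorkscrews Ω (t ∪ t') := by
  obtain ⟨η, r₀, hη, hr₀, H⟩ := h
  obtain ⟨η', r₀', hη', hr₀', H'⟩ := h'
  refine ⟨min η η', min r₀ r₀', lt_min hη hη', lt_min hr₀ hr₀', fun x hx r hr hrr => ?_⟩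
  rcases hx.1 with hx1 | hx1
  · obtain ⟨z, hz⟩ := H x ⟨hx1, hx.2⟩ r hr (hrr.trans (min_le_left _ _))
    exact ⟨z, (Metric.ball_subset_ball (by gcongr; exact min_le_left _ _)).trans hz⟩
  · obtain ⟨z, hz⟩ := H' x ⟨hx1, hx.2⟩ r hr (hrr.trans (min_le_right _ _))
    exact ⟨z, (Metric.ball_subset_ball (by gcongr; exact min_le_right _ _)).trans hz⟩

theorem hasCorkscrews_of_isOpen {d : ℕ} {Ω : Set (E d)} (hΩ : IsOpen Ω) {x₀ : E d}
    (hx₀ : x₀ ∈ Ω) : ∃ t ∈ 𝓝 x₀, HasCorkscrews Ω t := by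
  obtain ⟨ε, hε, h⟩ := Metric.isOpen_iff.1 hΩ x₀ hx₀
  refine ⟨Metric.ball x₀ (ε / 2), Metric.ball_mem_nhds _ (by positivity), 1, ε / 2, one_pos,
    by positivity, fun x hx r hr hrr => ⟨x, ?_⟩⟩
  rw [one_mul]
  refine subset_inter (Subset.trans ?_ h) subset_rfl
  exact Metric.ball_subset_ball' (by have := Metric.mem_ball.1 hx.1; linarith)

/-- From a point above the graph, move up by `ρ/2` along `ν`. A displacement `e` changes the height
by at most `‖e‖` and the graph by at most `L‖e‖`, so a ball of radius `ηρ` with `η(1 + L) < 1/2`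
stays above the graph. -/
theorem hasCorkscrews_of_graph {d : ℕ} {Ω : Set (E d)} {x₀ ν : E d} {g : E d → ℝ} {L : NNReal}
    {r : ℝ} (hν : ‖ν‖ = 1) (hr : 0 < r) (hg : LipschitzOnWith L g {y | inner ℝ ν y = 0})
    (h : ∀ (y : E d) (t : ℝ), inner ℝ ν y = 0 → y + t • ν ∈ Metric.ball x₀ r →
        (y + t • ν ∈ Ω ↔ g y < t)) :
    HasCorkscrews Ω (Metric.ball x₀ (r / 2)) := by
  have hL : (0 : ℝ) ≤ L := L.2
  have hdec : ∀ x : E d, inner ℝ ν (x - (inner ℝ ν x) • ν) = (0 : ℝ) := fun x => by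
    rw [inner_sub_right, inner_smul_right, real_inner_self_eq_norm_sq, hν]; ring
  -- Then `η(1 + L) = 1/4`, which leaves half of the vertical gap `ρ/2` as slack.
  obtain ⟨η, hηdef⟩ : ∃ η : ℝ, η = 1 / (4 * (1 + L)) := ⟨_, rfl⟩
  have hη : 0 < η := by rw [hηdef]; positivity
  have hη1 : η * (1 + L) = 1 / 4 := by rw [hηdef]; field_simp
  have hηL : 0 ≤ η * L := by positivity
  refine ⟨η, r / 2, hη, by positivity, fun x hx ρ hρ hρr => ⟨x + (ρ / 2) • ν, fun z hz => ?_⟩⟩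
  have hz' : ‖z - (x + (ρ / 2) • ν)‖ < η * ρ := by rwa [mem_ball_iff_norm] at hz
  obtain ⟨e, he⟩ : ∃ e, e = z - (x + (ρ / 2) • ν) := ⟨_, rfl⟩
  rw [← he] at hz'
  have hze : z - x = (ρ / 2) • ν + e := by rw [he]; abel
  have hzx : ‖z - x‖ < ρ := by
    rw [hze]
    refine (norm_add_le _ _).trans_lt ?_
    rw [norm_smul, hν, Real.norm_of_nonneg (by positivity)]
    nlinarith
  have hzball : z ∈ Metric.ball x₀ r := by
    have h1 := mem_ball_iff_norm.1 hx.1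
    rw [mem_ball_iff_norm]
    calc ‖z - x₀‖ = ‖(z - x) + (x - x₀)‖ := by congr 1; abel
      _ ≤ ‖z - x‖ + ‖x - x₀‖ := norm_add_le _ _
      _ < r := by linarith
  refine ⟨?_, mem_ball_iff_norm.2 hzx⟩
  have hsplit : ∀ x : E d, x - (inner ℝ ν x : ℝ) • ν + (inner ℝ ν x : ℝ) • ν = x := fun x => by
    abel
  have hxΩ : g (x - (inner ℝ ν x : ℝ) • ν) < inner ℝ ν x := by
    refine (h _ _ (hdec x) ?_).1 ?_
    · rw [hsplit]; exact Metric.ball_subset_ball (by linarith) hx.1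
    · rw [hsplit]; exact hx.2
  have hzin : (inner ℝ ν z : ℝ) = inner ℝ ν x + ρ / 2 + inner ℝ ν e := by
    have : z = x + ((ρ / 2) • ν + e) := by rw [← hze]; abel
    rw [this, inner_add_right, inner_add_right, inner_smul_right, real_inner_self_eq_norm_sq, hν]
    ring
  have hine : |inner ℝ ν e| ≤ ‖e‖ := by simpa [hν] using abs_real_inner_le_norm ν e
  have hproj : ‖e - (inner ℝ ν e : ℝ) • ν‖ ≤ ‖e‖ := by
    have h1 : ‖e - (inner ℝ ν e : ℝ) • ν‖ ^ 2 = ‖e‖ ^ 2 - (inner ℝ ν e : ℝ) ^ 2 := by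
      rw [norm_sub_sq_real, norm_smul, hν, inner_smul_right, real_inner_comm]
      rw [Real.norm_eq_abs, mul_one, sq_abs]; ring
    exact abs_le_of_sq_le_sq' (by rw [h1]; nlinarith [sq_nonneg (inner ℝ ν e : ℝ)])
      (norm_nonneg _) |>.2
  have hLip : g (z - (inner ℝ ν z : ℝ) • ν) - g (x - (inner ℝ ν x : ℝ) • ν) ≤ L * ‖e‖ := by
    have h1 := hg.dist_le_mul _ (hdec z) _ (hdec x)
    rw [Real.dist_eq, dist_eq_norm] at h1
    have h2 : z - (inner ℝ ν z : ℝ) • ν - (x - (inner ℝ ν x : ℝ) • ν)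
        = e - (inner ℝ ν e : ℝ) • ν := by
      have : z = x + ((ρ / 2) • ν + e) := by rw [← hze]; abel
      rw [hzin]
      nth_rw 1 [this]
      module
    rw [h2] at h1
    exact (le_abs_self _).trans (h1.trans (by gcongr))
  have hfin := (h (z - (inner ℝ ν z : ℝ) • ν) (inner ℝ ν z) (hdec z) (by rwa [hsplit])).2
  rw [hsplit] at hfin
  refine hfin ?_
  rw [hzin]
  have h5 := (abs_le.1 hine).1
  rw [hzin] at hLip
  have h6 : L * ‖e‖ ≤ L * (η * ρ) := by gcongr
  have h7 : η * ρ + L * (η * ρ) = ρ / 4 := by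
    have : η * ρ + L * (η * ρ) = η * (1 + L) * ρ := by ring
    rw [this, hη1]; ring
  linarith

/-- The closure is compact and the corkscrew property passes to subsets and finite unions, so local
constants at interior and boundary points give uniform ones. -/
theorem IsBoundedLipschitzDomain.hasCorkscrews {d : ℕ} {Ω : Set (E d)}
    (hΩ : IsBoundedLipschitzDomain Ω) : HasCorkscrews Ω univ := by
  have hcpt : IsCompact (closure Ω) := hΩ.isBounded.isCompact_closure
  have h : HasCorkscrews Ω (closure Ω) := by
    refine hcpt.induction_on (p := HasCorkscrews Ω) ⟨1, 1, one_pos, one_pos, by simp⟩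
      (fun s t hst ht => ht.mono hst) (fun s t hs ht => hs.union ht) fun x hx => ?_
    by_cases hxΩ : x ∈ Ω
    · obtain ⟨t, ht, h⟩ := hasCorkscrews_of_isOpen hΩ.isOpen hxΩ
      exact ⟨t, mem_nhdsWithin_of_mem_nhds ht, h⟩
    · obtain ⟨ν, g, L, r, hν, hr, hg, h⟩ := hΩ.lipschitz_boundary x
        (by rw [hΩ.isOpen.frontier_eq]; exact ⟨hx, hxΩ⟩)
      exact ⟨_, mem_nhdsWithin_of_mem_nhds (Metric.ball_mem_nhds _ (half_pos hr)),
        hasCorkscrews_of_graph hν hr hg h⟩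
  obtain ⟨η, r₀, hη, hr₀, H⟩ := h
  exact ⟨η, r₀, hη, hr₀, fun x hx => H x ⟨subset_closure hx.2, hx.2⟩⟩

/-- The volume of the unit ball. -/
noncomputable def unitBallVolume (d : ℕ) : ℝ := (volume (Metric.ball (0 : E d) 1)).toReal

theorem unitBallVolume_pos (d : ℕ) : 0 < unitBallVolume d :=
  ENNReal.toReal_pos (Metric.measure_ball_pos _ _ one_pos).ne' measure_ball_lt_top.ne

theorem volume_ball_eq {d : ℕ} (x : E d) {r : ℝ} (hr : 0 < r) :
    volume (Metric.ball x r) = ENNReal.ofReal (unitBallVolume d * r ^ d) := by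
  rw [Measure.addHaar_ball_of_pos _ _ hr, mul_comm (unitBallVolume d), ENNReal.ofReal_mul
    (by positivity), unitBallVolume, ENNReal.ofReal_toReal measure_ball_lt_top.ne]
  simp

theorem hasMeasureDensity_univ (d : ℕ) :
    HasMeasureDensity (univ : Set (E d)) (unitBallVolume d) 1 :=
  ⟨unitBallVolume_pos d, one_pos, fun x _ r hr _ => by rw [univ_inter, volume_ball_eq x hr]⟩

theorem IsBoundedLipschitzDomain.exists_hasMeasureDensity {d : ℕ} {Ω : Set (E d)}
    (hΩ : IsBoundedLipschitzDomain Ω) : ∃ c r₀, HasMeasureDensity Ω c r₀ := by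
  obtain ⟨η, r₀, hη, hr₀, H⟩ := hΩ.hasCorkscrews
  have := unitBallVolume_pos d
  refine ⟨unitBallVolume d * η ^ d, r₀, by positivity, hr₀, fun x hx r hr hrr => ?_⟩
  obtain ⟨z, hz⟩ := H x ⟨mem_univ _, hx⟩ r hr hrr
  calc _ = volume (Metric.ball z (η * r)) := by
        rw [volume_ball_eq z (by positivity)]; congr 1; rw [mul_pow]; ring
    _ ≤ _ := measure_mono hz

end SparseFrac

namespace SparseFrac

variable {d : ℕ} {s : ℝ} {D : Set (E d)} {w v : E d → ℝ}

/-! ### Fractional difference quotients -/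

/-- The difference quotient whose square is the Gagliardo integrand. -/
noncomputable def diffQuot (s : ℝ) (w : E d → ℝ) (z : E d × E d) : ℝ :=
  (w z.1 - w z.2) / ‖z.1 - z.2‖ ^ ((d : ℝ) / 2 + s)

theorem diffQuot_sub (w v : E d → ℝ) (z : E d × E d) :
    diffQuot s (fun x => w x - v x) z = diffQuot s w z - diffQuot s v z := by
  unfold diffQuot; ring

theorem diffQuot_const_mul (c : ℝ) (w : E d → ℝ) (z : E d × E d) :
    diffQuot s (fun x => c * w x) z = c * diffQuot s w z := by
  unfold diffQuot; ring

theorem diffQuot_sq (w : E d → ℝ) (z : E d × E d) :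
    diffQuot s w z ^ 2 = |w z.1 - w z.2| ^ 2 / ‖z.1 - z.2‖ ^ ((d : ℝ) + 2 * s) := by
  have h : (‖z.1 - z.2‖ ^ ((d : ℝ) / 2 + s)) ^ 2 = ‖z.1 - z.2‖ ^ ((d : ℝ) + 2 * s) := by
    rw [← Real.rpow_natCast, ← Real.rpow_mul (norm_nonneg _)]
    congr 1; push_cast; ring
  rw [diffQuot, div_pow, h, sq_abs]

theorem abs_diffQuot_le {G : ℝ → ℝ} (hG : ∀ a b, |G a - G b| ≤ |a - b|) (w : E d → ℝ)
    (z : E d × E d) : |diffQuot s (fun x => G (w x)) z| ≤ |diffQuot s w z| := by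
  unfold diffQuot
  rw [abs_div, abs_div]
  exact div_le_div_of_nonneg_right (hG _ _) (abs_nonneg _)

theorem aestronglyMeasurable_diffQuot (hw : AEStronglyMeasurable w (volume.restrict D)) :
    AEStronglyMeasurable (diffQuot s w) ((volume.restrict D).prod (volume.restrict D)) := by
  have h : AEStronglyMeasurable (fun z : E d × E d => ‖z.1 - z.2‖ ^ ((d : ℝ) / 2 + s))
      ((volume.restrict D).prod (volume.restrict D)) :=
    (Measurable.pow_const (by fun_prop) _).aestronglyMeasurable
  exact (hw.comp_fst.sub hw.comp_snd).div₀ h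

/-- The signed quotient is linear in `w`, unlike the one with absolute values; all later
computations use it. -/
theorem memHs_iff : MemHs s D w ↔ MemLp w 2 (volume.restrict D) ∧
    MemLp (diffQuot s w) 2 ((volume.restrict D).prod (volume.restrict D)) := by
  refine and_congr_right fun hw => ?_
  have hm := aestronglyMeasurable_diffQuot (s := s) hw.1
  have h : (fun z : E d × E d => |w z.1 - w z.2| / ‖z.1 - z.2‖ ^ ((d : ℝ) / 2 + s))
      = fun z => ‖diffQuot s w z‖ := by
    ext z
    rw [diffQuot, Real.norm_eq_abs, abs_div, abs_of_nonneg (a := ‖z.1 - z.2‖ ^ _) (by positivity)]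
  rw [h, memLp_norm_iff hm]

theorem diffQuot_congr (h : w =ᵐ[volume.restrict D] v) :
    diffQuot s w =ᵐ[(volume.restrict D).prod (volume.restrict D)] diffQuot s v := by
  filter_upwards [Measure.quasiMeasurePreserving_fst.ae h,
    Measure.quasiMeasurePreserving_snd.ae h] with z h1 h2
  simp only [diffQuot, h1, h2]

theorem MemHs.congr (hw : MemHs s D w) (h : w =ᵐ[volume.restrict D] v) : MemHs s D v := by
  rw [memHs_iff] at hw ⊢
  exact ⟨hw.1.ae_eq h, hw.2.ae_eq (diffQuot_congr h)⟩

theorem MemHs.sub (hw : MemHs s D w) (hv : MemHs s D v) : MemHs s D (fun x => w x - v x) := by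
  rw [memHs_iff] at hw hv ⊢
  refine ⟨hw.1.sub hv.1, (hw.2.sub hv.2).ae_eq (ae_of_all _ fun z => ?_)⟩
  exact (diffQuot_sub w v z).symm

theorem MemHs.const_mul (hw : MemHs s D w) (c : ℝ) : MemHs s D (fun x => c * w x) := by
  rw [memHs_iff] at hw ⊢
  refine ⟨hw.1.const_mul c, (hw.2.const_mul c).ae_eq (ae_of_all _ fun z => ?_)⟩
  exact (diffQuot_const_mul c w z).symm

theorem MemHs.comp_contraction (hw : MemHs s D w) {G : ℝ → ℝ}
    (hG : ∀ a b, |G a - G b| ≤ |a - b|) (hG0 : G 0 = 0) : MemHs s D (fun x => G (w x)) := by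
  have hc : Continuous G :=
    (LipschitzWith.of_dist_le_mul (K := 1) fun x y => by simpa [Real.dist_eq] using hG x y).continuous
  rw [memHs_iff] at hw ⊢
  have h1 : AEStronglyMeasurable (fun x => G (w x)) (volume.restrict D) :=
    hc.comp_aestronglyMeasurable hw.1.1
  refine ⟨hw.1.mono h1 (ae_of_all _ fun x => ?_), hw.2.mono (aestronglyMeasurable_diffQuot h1)
    (ae_of_all _ fun z => abs_diffQuot_le hG w z)⟩
  simpa [hG0] using hG (w x) 0

/-- By Fubini the squared norm is a combination of two squared `L²` norms, so quadratic expansions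
can be done under each integral. -/
theorem MemHs.hsNormSq_eq (hw : MemHs s D w) :
    hsNormSq s D w = (∫ x in D, w x ^ 2) +
      fracConst d s / 2 * ∫ z, diffQuot s w z ^ 2 ∂(volume.restrict D).prod (volume.restrict D) := by
  rw [integral_prod _ (memHs_iff.1 hw).2.integrable_sq]
  simp only [hsNormSq, diffQuot_sq, sq_abs]

theorem MemHs.hsNormSq_congr (hw : MemHs s D w) (h : w =ᵐ[volume.restrict D] v) :
    hsNormSq s D w = hsNormSq s D v := by
  rw [hw.hsNormSq_eq, (hw.congr h).hsNormSq_eq]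
  congr 1
  · exact integral_congr_ae (h.mono fun x hx => by simp only [hx])
  · congr 1
    exact integral_congr_ae ((diffQuot_congr (s := s) h).mono fun x hx => by simp only [hx])

theorem fracConst_pos (hd : 1 ≤ d) (hs0 : 0 < s) (hs1 : s < 1) : 0 < fracConst d s := by
  have h1 : 0 < Real.Gamma (s + d / 2) := Real.Gamma_pos_of_pos (by positivity)
  have h2 : 0 < Real.Gamma (1 - s) := Real.Gamma_pos_of_pos (by linarith)
  unfold fracConst
  positivity

theorem MemHs.hsNormSq_const_mul (hw : MemHs s D w) (c : ℝ) :
    hsNormSq s D (fun x => c * w x) = c ^ 2 * hsNormSq s D w := by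
  rw [hw.hsNormSq_eq, (hw.const_mul c).hsNormSq_eq]
  simp only [diffQuot_const_mul, mul_pow, integral_const_mul]
  ring

/-! ### Excess functions -/

/-- The excess `(w - k)^+` of `w` over the level `k`. -/
noncomputable def excess (k : ℝ) (w : E d → ℝ) (x : E d) : ℝ := max (w x - k) 0

theorem excess_nonneg (k : ℝ) (w : E d → ℝ) (x : E d) : 0 ≤ excess k w x := le_max_right _ _

theorem abs_max_sub_max_le (k a b : ℝ) : |max (a - k) 0 - max (b - k) 0| ≤ |a - b| := by
  have := abs_max_sub_max_le_abs (a - k) (b - k) 0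
  simpa using this

theorem sub_excess (k : ℝ) (w : E d → ℝ) (x : E d) : w x - excess k w x = min (w x) k := by
  unfold excess
  rcases le_total (w x) k with h | h
  · rw [max_eq_right (by linarith), min_eq_left h, sub_zero]
  · rw [max_eq_left (by linarith), min_eq_right h]; ring

theorem MemHs.excess (hw : MemHs s D w) {k : ℝ} (hk : 0 ≤ k) : MemHs s D (excess k w) :=
  hw.comp_contraction (G := fun a => max (a - k) 0) (abs_max_sub_max_le k) (by simpa using hk)

theorem sq_excess_le {k : ℝ} (hk : 0 ≤ k) (w : E d → ℝ) (x : E d) :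
    excess k w x ^ 2 ≤ w x * excess k w x := by
  unfold SparseFrac.excess
  rcases le_total (w x - k) 0 with h | h
  · rw [max_eq_right h]; simp
  · rw [max_eq_left h]; nlinarith

/-- With `w = min w k + (w - k)^+`, both summands are nondecreasing functions of `w`; their
increments have the same sign, so the mixed product is nonnegative. -/
theorem sq_diffQuot_excess_le (k : ℝ) (w : E d → ℝ) (z : E d × E d) :
    diffQuot s (excess k w) z ^ 2 ≤ diffQuot s w z * diffQuot s (excess k w) z := by
  have h : (SparseFrac.excess k w z.1 - SparseFrac.excess k w z.2) ^ 2 ≤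
      (w z.1 - w z.2) * (SparseFrac.excess k w z.1 - SparseFrac.excess k w z.2) := by
    unfold SparseFrac.excess
    rcases le_total (w z.1 - k) 0 with h | h <;> rcases le_total (w z.2 - k) 0 with h' | h'
    · rw [max_eq_right h, max_eq_right h']; simp
    · rw [max_eq_right h, max_eq_left h']; nlinarith
    · rw [max_eq_left h, max_eq_right h']; nlinarith
    · rw [max_eq_left h, max_eq_left h']; nlinarith
  unfold diffQuot
  rw [div_pow, div_mul_div_comm, ← pow_two]
  gcongr

/-- Expand `(f - t g)²` and bound the cross term by `-2t f g ≤ -2t g²`. -/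
theorem integral_sub_sq_le {α : Type*} [MeasurableSpace α] {μ : Measure α} {f g h : α → ℝ}
    (hf : MemLp f 2 μ) (hg : MemLp g 2 μ) (hfg : ∀ x, g x ^ 2 ≤ f x * g x) {t : ℝ} (ht : 0 ≤ t)
    (hh : ∀ x, h x = f x - t * g x) :
    ∫ x, h x ^ 2 ∂μ ≤ ∫ x, f x ^ 2 ∂μ - 2 * t * ∫ x, g x ^ 2 ∂μ + t ^ 2 * ∫ x, g x ^ 2 ∂μ := by
  have hf2 := hf.integrable_sq
  have hg2 := hg.integrable_sq
  have h1 : MemLp h 2 μ := (hf.sub (hg.const_mul t)).ae_eq (ae_of_all _ fun x => (hh x).symm)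
  have h2 : Integrable (fun x => f x ^ 2 - 2 * t * g x ^ 2) μ := hf2.sub (hg2.const_mul _)
  rw [← integral_const_mul, ← integral_const_mul, ← integral_sub hf2 (hg2.const_mul _),
    ← integral_add h2 (hg2.const_mul _)]
  refine integral_mono h1.integrable_sq (h2.add (hg2.const_mul _)) fun x => ?_
  simp only [hh]
  nlinarith [mul_le_mul_of_nonneg_left (hfg x) ht]

theorem MemHs.hsNormSq_sub_excess_le (hd : 1 ≤ d) (hs0 : 0 < s) (hs1 : s < 1)
    (hw : MemHs s D w) {k : ℝ} (hk : 0 ≤ k) {t : ℝ} (ht : 0 ≤ t) :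
    hsNormSq s D (fun x => w x - t * SparseFrac.excess k w x) ≤
      hsNormSq s D w - 2 * t * hsNormSq s D (SparseFrac.excess k w)
        + t ^ 2 * hsNormSq s D (SparseFrac.excess k w) := by
  have hv := hw.excess hk
  have hw' := memHs_iff.1 hw
  have hv' := memHs_iff.1 hv
  rw [hw.hsNormSq_eq, hv.hsNormSq_eq, (hw.sub (hv.const_mul t)).hsNormSq_eq]
  have h1 := integral_sub_sq_le hw'.1 hv'.1 (sq_excess_le hk w) ht (fun x => rfl)
  have h2 := integral_sub_sq_le hw'.2 hv'.2 (sq_diffQuot_excess_le k w) ht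
    (h := diffQuot s (fun x => w x - t * SparseFrac.excess k w x))
    (fun z => by rw [diffQuot_sub, diffQuot_const_mul])
  have h3 := mul_le_mul_of_nonneg_left h2 (half_pos (fracConst_pos hd hs0 hs1)).le
  linarith

/-! ### A Faber–Krahn inequality -/

/-- Choose a ball so large that `D` fills measure `2a` of it. At least `a` of this lies where `v`
vanishes, and there the Gagliardo integrand at `x` is at least `v(x)² / r^{d+2s}`. Integrating in
`x` gives the claim; no boundary condition is needed. -/
theorem HasMeasureDensity.integral_sq_le {c r₀ : ℝ} (hD : HasMeasureDensity D c r₀)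
    (hDm : MeasurableSet D) (hd : 1 ≤ d) (hs0 : 0 < s) (hv : MemHs s D v) {a : ℝ} (ha0 : 0 < a)
    (ha : volume (D ∩ {x | v x ≠ 0}) ≤ ENNReal.ofReal a) (har : 2 * a / c ≤ r₀ ^ d) :
    ∫ x in D, v x ^ 2 ≤ (2 / c) ^ (1 + 2 * s / d) * a ^ (2 * s / d) *
      ∫ z, diffQuot s v z ^ 2 ∂(volume.restrict D).prod (volume.restrict D) := by
  obtain ⟨hc, hr₀, H⟩ := hD
  have hd0 : (0 : ℝ) < d := by exact_mod_cast hd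
  have hdne : d ≠ 0 := by omega
  have hv' := memHs_iff.1 hv
  -- The radius solves `c r^d = 2a`; the smallness of `a` guarantees `r ≤ r₀`.
  obtain ⟨r, hr⟩ : ∃ r : ℝ, r = (2 * a / c) ^ ((d : ℝ)⁻¹) := ⟨_, rfl⟩
  have hr0 : 0 < r := by rw [hr]; positivity
  have hrd : r ^ d = 2 * a / c := by
    rw [hr, Real.rpow_inv_natCast_pow (by positivity) hdne]
  have hrr : r ≤ r₀ := by
    rw [← pow_le_pow_iff_left₀ hr0.le hr₀.le hdne, hrd]; exact har
  have hcr : c * r ^ d = a + a := by rw [hrd]; field_simp; ring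
  -- `v` is only almost everywhere measurable, so its support is replaced by a measurable hull of
  -- the same measure.
  obtain ⟨A, hA⟩ : ∃ A, A = toMeasurable volume (D ∩ {x | v x ≠ 0}) := ⟨_, rfl⟩
  have hAm : MeasurableSet A := hA ▸ measurableSet_toMeasurable _ _
  have hAv : volume A ≤ ENNReal.ofReal a := by rw [hA, measure_toMeasurable]; exact ha
  have hAs : D ∩ {x | v x ≠ 0} ⊆ A := hA ▸ subset_toMeasurable _ _
  have hpt : ∀ x ∈ D, ENNReal.ofReal (v x ^ 2) * ENNReal.ofReal (a / r ^ ((d : ℝ) + 2 * s)) ≤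
      ∫⁻ y in D, ENNReal.ofReal (diffQuot s v (x, y) ^ 2) := by
    intro x hx
    by_cases hvx : v x = 0
    · simp [hvx]
    obtain ⟨S, hS⟩ : ∃ S, S = (D ∩ Metric.ball x r) \ A := ⟨_, rfl⟩
    have hSm : MeasurableSet S := hS ▸ (hDm.inter measurableSet_ball).diff hAm
    have hSv : ENNReal.ofReal a ≤ volume S := by
      rw [hS]
      refine le_trans ?_ le_measure_sdiff
      refine le_trans ?_ (tsub_le_tsub (H x hx r hr0 hrr) hAv)
      rw [hcr, ENNReal.ofReal_add ha0.le ha0.le]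
      simp
    calc _ = ENNReal.ofReal (v x ^ 2 / r ^ ((d : ℝ) + 2 * s)) * ENNReal.ofReal a := by
          rw [← ENNReal.ofReal_mul (by positivity), ← ENNReal.ofReal_mul (by positivity)]
          congr 1; ring
      _ ≤ ENNReal.ofReal (v x ^ 2 / r ^ ((d : ℝ) + 2 * s)) * volume S := by gcongr
      _ = ∫⁻ y in S, ENNReal.ofReal (v x ^ 2 / r ^ ((d : ℝ) + 2 * s)) := by
          rw [setLIntegral_const]
      _ ≤ ∫⁻ y in S, ENNReal.ofReal (diffQuot s v (x, y) ^ 2) := by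
          refine setLIntegral_mono' hSm fun y hy => ?_
          rw [hS] at hy
          have hvy : v y = 0 := by
            by_contra h
            exact hy.2 (hAs ⟨hy.1.1, h⟩)
          have hxy : x ≠ y := by rintro rfl; exact hvx hvy
          have h1 : 0 < ‖x - y‖ := norm_pos_iff.2 (sub_ne_zero.2 hxy)
          have h2 : ‖x - y‖ ≤ r := by
            have := mem_ball_iff_norm'.1 hy.1.2; exact this.le
          rw [diffQuot_sq, hvy, sub_zero, sq_abs]
          gcongr
      _ ≤ _ := lintegral_mono_set (hS ▸ sdiff_subset.trans inter_subset_left)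
  have hint : ENNReal.ofReal (∫ x in D, v x ^ 2) * ENNReal.ofReal (a / r ^ ((d : ℝ) + 2 * s)) ≤
      ENNReal.ofReal (∫ z, diffQuot s v z ^ 2 ∂(volume.restrict D).prod (volume.restrict D)) := by
    rw [ofReal_integral_eq_lintegral_ofReal hv'.1.integrable_sq (ae_of_all _ fun x => sq_nonneg _),
      ofReal_integral_eq_lintegral_ofReal hv'.2.integrable_sq (ae_of_all _ fun x => sq_nonneg _),
      lintegral_prod _ hv'.2.integrable_sq.1.aemeasurable.ennreal_ofReal,
      ← lintegral_mul_const' _ _ ENNReal.ofReal_ne_top]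
    exact setLIntegral_mono' hDm hpt
  rw [← ENNReal.ofReal_mul (integral_nonneg fun x => sq_nonneg _),
    ENNReal.ofReal_le_ofReal_iff (integral_nonneg fun x => sq_nonneg _)] at hint
  have hconst : a / r ^ ((d : ℝ) + 2 * s) * ((2 / c) ^ (1 + 2 * s / d) * a ^ (2 * s / d)) = 1 := by
    have h1 : r ^ ((d : ℝ) + 2 * s) = (2 / c) ^ (1 + 2 * s / d) * a ^ (1 + 2 * s / d) := by
      rw [hr, ← Real.rpow_mul (by positivity), ← Real.mul_rpow (by positivity) ha0.le]
      congr 1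
      · ring
      · field_simp
    rw [h1, Real.rpow_add ha0, Real.rpow_one]
    field_simp
  calc ∫ x in D, v x ^ 2 = (∫ x in D, v x ^ 2) * (a / r ^ ((d : ℝ) + 2 * s)) *
        ((2 / c) ^ (1 + 2 * s / d) * a ^ (2 * s / d)) := by rw [mul_assoc, hconst, mul_one]
    _ ≤ _ := by rw [mul_comm]; gcongr

theorem HasMeasureDensity.integral_sq_le_hsNormSq {c r₀ : ℝ} (hD : HasMeasureDensity D c r₀)
    (hDm : MeasurableSet D) (hd : 1 ≤ d) (hs0 : 0 < s) (hs1 : s < 1) (hv : MemHs s D v) {a : ℝ}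
    (ha0 : 0 < a) (ha : volume (D ∩ {x | v x ≠ 0}) ≤ ENNReal.ofReal a)
    (har : 2 * a / c ≤ r₀ ^ d) :
    ∫ x in D, v x ^ 2 ≤ (2 / c) ^ (1 + 2 * s / d) * (2 / fracConst d s) * a ^ (2 * s / d) *
      hsNormSq s D v := by
  have hc := hD.1
  have hf := fracConst_pos hd hs0 hs1
  refine (hD.integral_sq_le hDm hd hs0 hv ha0 ha har).trans ?_
  rw [hv.hsNormSq_eq]
  have h1 : 0 ≤ ∫ x in D, v x ^ 2 := integral_nonneg fun x => sq_nonneg _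
  obtain ⟨J, hJ⟩ : ∃ J, J = ∫ z, diffQuot s v z ^ 2 ∂(volume.restrict D).prod
    (volume.restrict D) := ⟨_, rfl⟩
  rw [← hJ]
  have h2 : J ≤ (2 / fracConst d s) * ((∫ x in D, v x ^ 2) + fracConst d s / 2 * J) := by
    have : (2 / fracConst d s) * ((∫ x in D, v x ^ 2) + fracConst d s / 2 * J)
        = (2 / fracConst d s) * (∫ x in D, v x ^ 2) + J := by field_simp
    rw [this]
    have : 0 ≤ (2 / fracConst d s) * (∫ x in D, v x ^ 2) := by positivity
    linarith
  calc _ ≤ (2 / c) ^ (1 + 2 * s / d) * a ^ (2 * s / d) *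
        ((2 / fracConst d s) * ((∫ x in D, v x ^ 2) + fracConst d s / 2 * J)) := by gcongr
    _ = _ := by ring

end SparseFrac

namespace SparseFrac

variable {d : ℕ} {s : ℝ} {Ω : Set (E d)}

/-! ### From truncation in `W` to boundedness of local solutions -/

/-- Lowering `w` towards `min w k` stays in `W` and decreases the squared norm by a quantity `Q`
which controls the excess of `w` over `k` through a Faber–Krahn inequality. -/
def FracSpace.HasTruncation (W : FracSpace Ω) (s : ℝ) (w : E d → ℝ) : Prop :=
  ∃ C a₀ : ℝ, 0 ≤ C ∧ 0 < a₀ ∧ ∀ k : ℝ, 0 < k → ∃ Q : ℝ, 0 ≤ Q ∧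
    (∀ a : ℝ, 0 < a → a ≤ a₀ → volume (Ω ∩ {x | excess k w x ≠ 0}) ≤ ENNReal.ofReal a →
      ∫ x in Ω, excess k w x ^ 2 ≤ C * a ^ (2 * s / d) * Q) ∧
    ∀ t : ℝ, 0 ≤ t → t ≤ 1 → ∀ w' : E d → ℝ,
      w' =ᵐ[volume.restrict Ω] (fun x => w x - t * excess k w x) →
      W.Mem s w' ∧ W.normSq s w' ≤ W.normSq s w - 2 * t * Q + t ^ 2 * Q ∧
        W.normSq s (fun x => w' x - w x) ≤ t ^ 2 * Q

/-- The bound `0 ≤ |u| ≤ w` holds on the cylinder; since `T > 0`, some time slice carries it to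
almost all of `Ω`. -/
theorem Admissible.ae_nonneg {T : ℝ} (hT : 0 < T) {W : FracSpace Ω} {u : U T Ω}
    {w : Lp ℝ 2 (volume.restrict Ω)} (h : Admissible T s W u w) :
    ∀ᵐ x ∂volume.restrict Ω, 0 ≤ w x := by
  have h1 : ∀ᵐ z ∂cylMeasure T Ω, 0 ≤ w z.2 := h.2.mono fun z hz => (abs_nonneg _).trans hz
  have h2 := Measure.ae_ae_of_ae_prod h1
  have : (ae (volume.restrict (Ioo 0 T))).NeBot := by
    rw [ae_neBot, Ne, Measure.restrict_eq_zero, Real.volume_Ioo]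
    simpa using hT
  exact h2.exists.choose_spec

theorem memLp_excess {μ : Measure (E d)} {w : E d → ℝ} (hw : MemLp w 2 μ) {k : ℝ} (hk : 0 ≤ k) :
    MemLp (excess k w) 2 μ := by
  have hc : Continuous fun a : ℝ => max (a - k) 0 := by fun_prop
  refine hw.mono (hc.comp_aestronglyMeasurable hw.1) (ae_of_all _ fun x => ?_)
  have h := abs_max_sub_max_le k (w x) 0
  rwa [zero_sub, max_eq_right (neg_nonpos.2 hk), sub_zero, sub_zero] at h

theorem integrable_abs_rpow {α : Type*} [MeasurableSpace α] {μ : Measure α} [IsFiniteMeasure μ]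
    {w : α → ℝ} (hw : MemLp w 2 μ) {p : ℝ} (hp0 : 0 < p) (hp1 : p < 1) :
    Integrable (fun x => |w x| ^ p) μ := by
  have hc : Continuous fun a : ℝ => |a| ^ p :=
    continuous_abs.rpow_const fun _ => Or.inr hp0.le
  refine Integrable.mono' ((integrable_const 1).add hw.integrable_sq)
    (hc.comp_aestronglyMeasurable hw.1) (ae_of_all _ fun x => ?_)
  rw [Real.norm_of_nonneg (by positivity)]
  simp only [Pi.add_apply]
  rcases le_total |w x| 1 with h | h
  · have := Real.rpow_le_one (abs_nonneg _) h hp0.le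
    nlinarith [sq_nonneg (w x)]
  · have h1 : |w x| ^ p ≤ |w x| ^ (2 : ℝ) := Real.rpow_le_rpow_of_exponent_le h (by linarith)
    have h2 : |w x| ^ (2 : ℝ) = w x ^ 2 := by simp
    linarith

/-- Clipping at a lower bound function. -/
theorem abs_clip_sub_le {a b c : ℝ} (ha : |a| ≤ b) (hc : 0 ≤ c) (hcb : c ≤ b) :
    |max (-c) (min a c) - a| ≤ b - c ∧ |max (-c) (min a c)| ≤ c ∧ |max (-c) (min a c)| ≤ |a| := by
  rcases abs_le.1 ha with ⟨h1, h2⟩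
  rcases le_total a c with h | h
  · rw [min_eq_left h]
    rcases le_total (-c) a with h' | h'
    · rw [max_eq_right h']
      exact ⟨by simpa using hcb, abs_le.2 ⟨h', h⟩, le_rfl⟩
    · rw [max_eq_left h', abs_neg, abs_of_nonneg hc, abs_of_nonpos (a := a) (by linarith)]
      exact ⟨abs_le.2 ⟨by linarith, by linarith⟩, le_rfl, by linarith⟩
  · rw [min_eq_right h, max_eq_right (by linarith), abs_of_nonneg hc,
      abs_of_nonneg (a := a) (by linarith)]
    exact ⟨abs_le.2 ⟨by linarith, by linarith⟩, le_rfl, h⟩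

/-- Clip `u` to `[-w', w']`. Where `|u| ≤ w` this moves `u` by at most `w - w' = t v`, and `v` does
not depend on time, whence the factor `T`. -/
theorem exists_clip {T : ℝ} (hT : 0 < T) {u : U T Ω} {w w' : E d → ℝ}
    {v : E d → ℝ} {t : ℝ} (ht : 0 ≤ t) (hv : MemLp v 2 (volume.restrict Ω))
    (hw'm : AEStronglyMeasurable w' (volume.restrict Ω))
    (huw : ∀ᵐ z ∂cylMeasure T Ω, |u z| ≤ w z.2)
    (hw' : ∀ᵐ x ∂volume.restrict Ω, 0 ≤ w' x ∧ w' x ≤ w x ∧ w x - w' x = t * v x) :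
    ∃ u' : U T Ω, (∀ᵐ z ∂cylMeasure T Ω, |u' z| ≤ w' z.2) ∧ ‖u'‖ ≤ ‖u‖ ∧
      ‖u' - u‖ ≤ t * √(T * ∫ x in Ω, v x ^ 2) := by
  have hu : AEStronglyMeasurable u (cylMeasure T Ω) := Lp.aestronglyMeasurable u
  have hw2 : AEStronglyMeasurable (fun z : ℝ × E d => w' z.2) (cylMeasure T Ω) := hw'm.comp_snd
  have hz : ∀ᵐ z ∂cylMeasure T Ω,
      0 ≤ w' z.2 ∧ w' z.2 ≤ w z.2 ∧ w z.2 - w' z.2 = t * v z.2 :=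
    Measure.quasiMeasurePreserving_snd.ae hw'
  have hm : AEStronglyMeasurable (fun z => max (-(w' z.2)) (min (u z) (w' z.2)))
      (cylMeasure T Ω) := hw2.neg.sup (hu.inf hw2)
  have hmem : MemLp (fun z => max (-(w' z.2)) (min (u z) (w' z.2))) 2 (cylMeasure T Ω) := by
    refine (Lp.memLp u).mono hm ?_
    filter_upwards [huw, hz] with z h1 h2
    exact (abs_clip_sub_le h1 h2.1 h2.2.1).2.2
  have hco := hmem.coeFn_toLp
  refine ⟨hmem.toLp _, ?_, ?_, ?_⟩
  · filter_upwards [hco, huw, hz] with z h0 h1 h2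
    rw [h0]
    exact (abs_clip_sub_le h1 h2.1 h2.2.1).2.1
  · refine Lp.norm_le_norm_of_ae_le ?_
    filter_upwards [hco, huw, hz] with z h0 h1 h2
    rw [h0]
    exact (abs_clip_sub_le h1 h2.1 h2.2.1).2.2
  · have hv2 : MemLp (fun z : ℝ × E d => v z.2) 2 (cylMeasure T Ω) := hv.comp_snd _
    have hsq : ∫ z, v z.2 ^ 2 ∂cylMeasure T Ω = T * ∫ x in Ω, v x ^ 2 := by
      have h := integral_prod_mul (μ := volume.restrict (Ioo 0 T)) (ν := volume.restrict Ω)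
        (fun _ => (1 : ℝ)) (fun x => v x ^ 2)
      simp only [one_mul] at h
      rw [h]
      simp [hT.le]
    have hle : ‖hmem.toLp _ - u‖ ≤ ‖t • hv2.toLp _‖ := by
      refine Lp.norm_le_norm_of_ae_le ?_
      filter_upwards [hco, huw, hz, Lp.coeFn_sub (hmem.toLp _) u, Lp.coeFn_smul t (hv2.toLp _),
        hv2.coeFn_toLp] with z h0 h1 h2 h3 h4 h5
      rw [h3, h4, Pi.sub_apply, Pi.smul_apply, h0, h5, smul_eq_mul, ← h2.2.2]
      exact (abs_clip_sub_le h1 h2.1 h2.2.1).1.trans (le_abs_self _)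
    refine hle.trans ?_
    rw [norm_smul, Real.norm_of_nonneg ht]
    gcongr
    refine Real.le_sqrt_of_sq_le (le_of_eq ?_)
    rw [← hsq, ← real_inner_self_eq_norm_sq, L2.inner_def]
    refine integral_congr_ae ?_
    filter_upwards [hv2.coeFn_toLp] with z h
    rw [h]; simp [pow_two]

/-! ### Energy comparison at a local solution, and decay of level sets. -/

/-- The gain in the `W`-norm is of first order in `t`, so minimality forces it below the first-order
loss in `f`. The constant comes from the Lipschitz bound of `f` near `u` and hence does not depend
on the level. -/
theorem IsLocalSolution.exists_mul_le [IsFiniteMeasure (volume.restrict Ω)] {T : ℝ} (hT : 0 < T)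
    {W : FracSpace Ω} {p α β γ : ℝ} (hp0 : 0 < p) (hp1 : p < 1) (hα : 0 < α) (hβ : 0 < β)
    (hγ : 0 < γ) {f : U T Ω → ℝ} (hf : ContDiff ℝ 1 f) {u : U T Ω}
    {w : Lp ℝ 2 (volume.restrict Ω)} (h : IsLocalSolution T s p α β γ W f u w) :
    ∃ L : ℝ, 0 ≤ L ∧ ∀ k Q : ℝ, 0 < k → 0 ≤ Q →
      (∀ t : ℝ, 0 ≤ t → t ≤ 1 → ∀ w' : E d → ℝ,
        w' =ᵐ[volume.restrict Ω] (fun x => w x - t * excess k w x) →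
        W.Mem s w' ∧ W.normSq s w' ≤ W.normSq s w - 2 * t * Q + t ^ 2 * Q ∧
          W.normSq s (fun x => w' x - w x) ≤ t ^ 2 * Q) →
      Q ≤ L * √(∫ x in Ω, excess k w x ^ 2) := by
  obtain ⟨hadm, ρ, hρ, hmin⟩ := h
  have hw0 := hadm.ae_nonneg hT
  obtain ⟨K, S, hS, hK⟩ := hf.contDiffAt.exists_lipschitzOnWith (x := u)
  obtain ⟨δ, hδ, hδS⟩ := Metric.mem_nhds_iff.1 hS
  refine ⟨2 * (K * √T) / β, by positivity, fun k Q hk hQ H => ?_⟩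
  have hwm : MemLp w 2 (volume.restrict Ω) := Lp.memLp w
  have hvm := memLp_excess hwm hk.le
  obtain ⟨y, hy⟩ : ∃ y, y = ∫ x in Ω, excess k w x ^ 2 := ⟨_, rfl⟩
  rw [← hy]
  obtain ⟨N, hN⟩ : ∃ N, N = √(T * y) := ⟨_, rfl⟩
  have hN0 : 0 ≤ N := hN ▸ Real.sqrt_nonneg _
  -- `t` may depend on `k`, since it is divided out below. It keeps the competitor within `ρ` in
  -- both norms and within the ball where `f` is Lipschitz; `δ/2` makes the latter strict.
  obtain ⟨t, ht0, ht1, htN, htQ⟩ : ∃ t : ℝ, 0 < t ∧ t ≤ 1 ∧ t * N ≤ min ρ (δ / 2) ∧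
      t * √Q ≤ ρ := by
    have h1 : 0 < N + √Q + 1 := by positivity
    have h2 : 0 < min ρ (δ / 2) := lt_min hρ (by positivity)
    refine ⟨min 1 (min ρ (δ / 2) / (N + √Q + 1)), by positivity, min_le_left _ _, ?_, ?_⟩
    · calc _ ≤ min ρ (δ / 2) / (N + √Q + 1) * (N + √Q + 1) := by
            gcongr
            · exact min_le_right _ _
            · linarith [Real.sqrt_nonneg Q]
        _ = _ := div_mul_cancel₀ _ h1.ne'
    · calc _ ≤ min ρ (δ / 2) / (N + √Q + 1) * (N + √Q + 1) := by
            gcongr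
            · exact min_le_right _ _
            · linarith
        _ = min ρ (δ / 2) := div_mul_cancel₀ _ h1.ne'
        _ ≤ ρ := min_le_left _ _
  have hw'm : MemLp (fun x => w x - t * excess k w x) 2 (volume.restrict Ω) :=
    hwm.sub (hvm.const_mul t)
  have hco := hw'm.coeFn_toLp
  obtain ⟨hM, hS1, hS2⟩ := H t ht0.le ht1 _ hco
  have hpt : ∀ᵐ x ∂volume.restrict Ω, 0 ≤ hw'm.toLp _ x ∧ hw'm.toLp _ x ≤ w x ∧
      w x - hw'm.toLp _ x = t * excess k w x := by
    filter_upwards [hw0, hco] with x h1 h2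
    rw [h2]
    have h3 := excess_nonneg k w x
    have h4 : excess k w x ≤ w x := max_le (by linarith) h1
    refine ⟨?_, ?_, by ring⟩ <;> nlinarith
  obtain ⟨u', hu1, hu2, hu3⟩ := exists_clip hT ht0.le hvm (Lp.aestronglyMeasurable _) hadm.2 hpt
  rw [← hy, ← hN] at hu3
  have hobj := hmin u' (hw'm.toLp _) ⟨hM, hu1⟩ (hu3.trans (htN.trans (min_le_left _ _))) (by
    refine (Real.sqrt_le_sqrt hS2).trans ?_
    rw [Real.sqrt_mul (sq_nonneg t), Real.sqrt_sq ht0.le]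
    exact htQ)
  have hfle : f u' ≤ f u + K * (t * N) := by
    have h1 : u' ∈ S := hδS (mem_ball_iff_norm.2
      ((hu3.trans (htN.trans (min_le_right _ _))).trans_lt (by linarith)))
    have h2 := hK.dist_le_mul u' h1 u (mem_of_mem_nhds hS)
    rw [Real.dist_eq, dist_eq_norm] at h2
    have h3 : (K : ℝ) * ‖u' - u‖ ≤ K * (t * N) := by gcongr
    linarith [le_abs_self (f u' - f u)]
  have hpow : ∫ x in Ω, |hw'm.toLp _ x| ^ p ≤ ∫ x in Ω, |w x| ^ p := by
    refine integral_mono_of_nonneg (ae_of_all _ fun x => by positivity)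
      (integrable_abs_rpow hwm hp0 hp1) ?_
    filter_upwards [hpt] with x hx
    refine Real.rpow_le_rpow (abs_nonneg _) ?_ hp0.le
    rw [abs_of_nonneg hx.1, abs_of_nonneg (hx.1.trans hx.2.1)]
    exact hx.2.1
  have hnorm : ‖u'‖ ^ 2 ≤ ‖u‖ ^ 2 := by gcongr
  unfold objective at hobj
  have h1 := mul_le_mul_of_nonneg_left hS1 (half_pos hβ).le
  have h2 := mul_le_mul_of_nonneg_left hpow hγ.le
  have h3 := mul_le_mul_of_nonneg_left hnorm (half_pos hα).le
  -- The objective comparison, with the `α`- and `γ`-terms discarded by sign; it remains to cancel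
  -- `t`.
  have h4 : t * (β * Q - β / 2 * (t * Q)) ≤ t * (K * N) := by nlinarith
  have h5 := le_of_mul_le_mul_left h4 ht0
  have h6 : β / 2 * (t * Q) ≤ β / 2 * Q := by
    gcongr
    exact mul_le_of_le_one_left hQ ht1
  have h7 : N = √T * √y := by rw [hN, Real.sqrt_mul hT.le]
  rw [div_mul_eq_mul_div, le_div_iff₀ hβ]
  rw [h7] at h5
  linarith

/-- Chebyshev's inequality: the excess over `k` is at least `l - k` on `{w > l}`. -/
theorem sq_sub_mul_measureReal_le [IsFiniteMeasure (volume.restrict Ω)] {w : E d → ℝ}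
    (hw : MemLp w 2 (volume.restrict Ω)) {k l : ℝ} (hk : 0 ≤ k) (hkl : k < l) :
    (l - k) ^ 2 * (volume.restrict Ω).real {x | l < w x} ≤ ∫ x in Ω, excess k w x ^ 2 := by
  refine le_trans ?_ (mul_meas_ge_le_integral_of_nonneg (ae_of_all _ fun x => sq_nonneg _)
    (memLp_excess hw hk).integrable_sq ((l - k) ^ 2))
  refine mul_le_mul_of_nonneg_left (measureReal_mono ?_) (sq_nonneg _)
  intro x hx
  have hx' : l < w x := hx
  change (l - k) ^ 2 ≤ excess k w x ^ 2
  have h1 : l - k ≤ excess k w x := (by linarith : l - k ≤ w x - k).trans (le_max_left _ _)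
  have : 0 ≤ l - k := by linarith
  gcongr

theorem exists_ae_le_of_faberKrahn (hd : 1 ≤ d) (hds : (d : ℝ) < 4 * s) (hΩ : MeasurableSet Ω)
    [IsFiniteMeasure (volume.restrict Ω)] {w : E d → ℝ} (hw : MemLp w 2 (volume.restrict Ω))
    {C a₀ L : ℝ} (hC : 0 ≤ C) (ha₀ : 0 < a₀) (hL : 0 ≤ L)
    (h : ∀ k : ℝ, 0 < k → ∃ Q : ℝ,
      (∀ a : ℝ, 0 < a → a ≤ a₀ → volume (Ω ∩ {x | excess k w x ≠ 0}) ≤ ENNReal.ofReal a →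
        ∫ x in Ω, excess k w x ^ 2 ≤ C * a ^ (2 * s / d) * Q) ∧
      Q ≤ L * √(∫ x in Ω, excess k w x ^ 2)) :
    ∃ k : ℝ, 0 < k ∧ ∀ᵐ x ∂volume.restrict Ω, w x ≤ k := by
  have hd0 : (0 : ℝ) < d := by exact_mod_cast hd
  obtain ⟨a, ha⟩ : ∃ a : ℝ → ℝ, a = fun k => (volume.restrict Ω).real {x | k < w x} := ⟨_, rfl⟩
  have hanti : Antitone a := by
    rw [ha]
    intro k l hkl
    exact measureReal_mono fun x (hx : l < w x) => hkl.trans_lt hx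
  have ha_nonneg : ∀ k, 0 ≤ a k := fun k => by rw [ha]; exact measureReal_nonneg
  have hset : ∀ k, volume (Ω ∩ {x | excess k w x ≠ 0}) = ENNReal.ofReal (a k) := by
    intro k
    rw [ha, ofReal_measureReal, Measure.restrict_apply' hΩ, inter_comm]
    congr 2
    ext x
    simp only [mem_ofPred_eq, excess]
    rcases le_or_gt (w x) k with h | h
    · simp [h]
    · rw [max_eq_left (by linarith)]
      exact ⟨fun _ => h, fun _ => by linarith⟩
  -- A starting level beyond which the superlevel sets are small enough for Faber–Krahn, found by
  -- Chebyshev from level `0`.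
  obtain ⟨k₀, hk₀, hak₀⟩ : ∃ k₀ : ℝ, 0 < k₀ ∧ a k₀ ≤ a₀ := by
    obtain ⟨Y, hY⟩ : ∃ Y, Y = ∫ x in Ω, excess 0 w x ^ 2 := ⟨_, rfl⟩
    have hY0 : 0 ≤ Y := hY ▸ integral_nonneg fun x => sq_nonneg _
    have hpos : 0 < √(Y / a₀) + 1 := by positivity
    refine ⟨√(Y / a₀) + 1, hpos, ?_⟩
    have h1 := sq_sub_mul_measureReal_le hw le_rfl hpos
    rw [← hY, sub_zero] at h1
    have h2 : Y ≤ (√(Y / a₀) + 1) ^ 2 * a₀ := by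
      rw [← div_le_iff₀ ha₀]
      nlinarith [Real.sq_sqrt (show 0 ≤ Y / a₀ by positivity), Real.sqrt_nonneg (Y / a₀)]
    have h3 : a (√(Y / a₀) + 1) = (volume.restrict Ω).real {x | √(Y / a₀) + 1 < w x} := by rw [ha]
    rw [← h3] at h1
    exact le_of_mul_le_mul_left (h1.trans h2) (by positivity)
  -- Here `σ = 4s/d > 1` is where `d < 4s` enters.
  obtain ⟨k, hk, hak⟩ := exists_eq_zero_of_sq_sub_mul_le ha_nonneg hanti (K := (C * L) ^ 2)
    (σ := 4 * s / d) (k₀ := k₀) (by positivity) (by rw [lt_div_iff₀ hd0]; linarith) (by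
      intro k l hk hkl
      -- Faber–Krahn is available only for positive `a`; an empty level set is handled by
      -- monotonicity.
      rcases (ha_nonneg k).eq_or_lt with h0 | h0
      · have h1 : a l = 0 := le_antisymm (h0 ▸ hanti hkl.le) (ha_nonneg l)
        rw [h1, mul_zero]
        have := ha_nonneg k
        positivity
      obtain ⟨Q, hQ1, hQ2⟩ := h k (hk₀.trans_le hk)
      have h1 := hQ1 (a k) h0 ((hanti hk).trans hak₀) (hset k).le
      have h2 := sq_sub_mul_measureReal_le hw (hk₀.le.trans hk) hkl
      have h3 : a l = (volume.restrict Ω).real {x | l < w x} := by rw [ha]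
      rw [← h3] at h2
      refine h2.trans ?_
      obtain ⟨y, hy⟩ : ∃ y, y = ∫ x in Ω, excess k w x ^ 2 := ⟨_, rfl⟩
      have hy0 : 0 ≤ y := hy ▸ integral_nonneg fun x => sq_nonneg _
      rw [← hy] at h1 hQ2 ⊢
      have h4 : y ≤ C * a k ^ (2 * s / d) * (L * √y) := h1.trans (by gcongr)
      have h5 : √y * √y ≤ C * L * a k ^ (2 * s / d) * √y := by
        rw [Real.mul_self_sqrt hy0]; linarith
      have h6 : √y ≤ C * L * a k ^ (2 * s / d) := by
        rcases (Real.sqrt_nonneg y).eq_or_lt with h | h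
        · rw [← h]; positivity
        · exact le_of_mul_le_mul_right h5 h
      have h7 : a k ^ (4 * s / d) = (a k ^ (2 * s / d)) ^ 2 := by
        rw [← Real.rpow_natCast, ← Real.rpow_mul h0.le]; congr 1; push_cast; ring
      rw [h7, ← mul_pow, ← Real.sq_sqrt hy0]
      gcongr)
  refine ⟨k, hk₀.trans_le hk, ?_⟩
  rw [ha] at hak
  have h1 := (measureReal_eq_zero_iff (by finiteness)).1 hak
  rw [ae_iff]
  simpa using h1

theorem IsLocalSolution.memLp_top (hd : 1 ≤ d) (hds : (d : ℝ) < 4 * s) (hΩ : MeasurableSet Ω)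
    [IsFiniteMeasure (volume.restrict Ω)] {T : ℝ} (hT : 0 < T)
    {W : FracSpace Ω} {p α β γ : ℝ} (hp0 : 0 < p) (hp1 : p < 1) (hα : 0 < α) (hβ : 0 < β)
    (hγ : 0 < γ) {f : U T Ω → ℝ} (hf : ContDiff ℝ 1 f) {u : U T Ω}
    {w : Lp ℝ 2 (volume.restrict Ω)} (h : IsLocalSolution T s p α β γ W f u w)
    (hW : W.HasTruncation s w) :
    MemLp w ∞ (volume.restrict Ω) ∧ MemLp u ∞ (cylMeasure T Ω) := by
  obtain ⟨C, a₀, hC, ha₀, H⟩ := hW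
  obtain ⟨L, hL, HL⟩ := h.exists_mul_le hT hp0 hp1 hα hβ hγ hf
  obtain ⟨k, hk, hwk⟩ := exists_ae_le_of_faberKrahn hd hds hΩ (Lp.memLp w) hC ha₀ hL fun k hk => by
    obtain ⟨Q, hQ, h1, h2⟩ := H k hk
    exact ⟨Q, h1, HL k Q hk hQ h2⟩
  refine ⟨memLp_top_of_bound (Lp.aestronglyMeasurable w) k ?_,
    memLp_top_of_bound (Lp.aestronglyMeasurable u) k ?_⟩
  · filter_upwards [hwk, h.1.ae_nonneg hT] with x h1 h2
    rwa [Real.norm_of_nonneg h2]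
  · filter_upwards [h.1.2, Measure.quasiMeasurePreserving_snd.ae hwk] with z h1 h2
    exact h1.trans h2

/-- When `d > 2s`, clearing the denominator in `4 < 2d/(d - 2s)` gives `d < 4s`; when `d ≤ 2s` it is
immediate. -/
theorem lt_four_mul_of_exponent (hd : 1 ≤ d)
    (hds : (d : ℝ) ≤ 2 * s ∨ (2 * s < (d : ℝ) ∧ 4 < 2 * (d : ℝ) / ((d : ℝ) - 2 * s))) :
    (d : ℝ) < 4 * s := by
  have hd0 : (1 : ℝ) ≤ d := by exact_mod_cast hd
  rcases hds with h | ⟨h1, h2⟩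
  · linarith
  · rw [lt_div_iff₀ (by linarith)] at h2
    linarith

/-! ### The Gagliardo spaces -/

theorem MemHs.hsNormSq_nonneg (hd : 1 ≤ d) (hs0 : 0 < s) (hs1 : s < 1) {D : Set (E d)}
    {w : E d → ℝ} (hw : MemHs s D w) : 0 ≤ hsNormSq s D w := by
  have hf := fracConst_pos hd hs0 hs1
  rw [hw.hsNormSq_eq]
  have h1 : 0 ≤ ∫ x in D, w x ^ 2 := integral_nonneg fun x => sq_nonneg _
  have h2 : 0 ≤ ∫ z, diffQuot s w z ^ 2 ∂(volume.restrict D).prod (volume.restrict D) :=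
    integral_nonneg fun z => sq_nonneg _
  positivity

theorem hasTruncation_full (hd : 1 ≤ d) (hs0 : 0 < s) (hs1 : s < 1)
    (hΩ : IsBoundedLipschitzDomain Ω) {w : E d → ℝ} (hw : MemHs s Ω w) :
    (FracSpace.full : FracSpace Ω).HasTruncation s w := by
  obtain ⟨c, r₀, hD⟩ := hΩ.exists_hasMeasureDensity
  have hc := hD.1
  have hr := hD.2.1
  have hf := fracConst_pos hd hs0 hs1
  refine ⟨(2 / c) ^ (1 + 2 * s / d) * (2 / fracConst d s), c * r₀ ^ d / 2, by positivity,
    by positivity, fun k hk => ⟨hsNormSq s Ω (excess k w), ?_, fun a ha0 ha h => ?_,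
    fun t ht0 ht1 w' hw' => ?_⟩⟩
  · exact (hw.excess hk.le).hsNormSq_nonneg hd hs0 hs1
  · exact hD.integral_sq_le_hsNormSq hΩ.isOpen.measurableSet hd hs0 hs1 (hw.excess hk.le) ha0 h
      (by rw [div_le_iff₀ hc]; linarith)
  · have h1 := hw.sub ((hw.excess hk.le).const_mul t)
    have h2 := h1.congr hw'.symm
    refine ⟨h2, ?_, ?_⟩
    · change hsNormSq s Ω w' ≤ hsNormSq s Ω w - _ + _
      rw [h2.hsNormSq_congr hw']
      exact hw.hsNormSq_sub_excess_le hd hs0 hs1 hk.le ht0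
    · change hsNormSq s Ω _ ≤ _
      have h3 : (fun x => w' x - w x) =ᵐ[volume.restrict Ω] fun x => (-t) * excess k w x := by
        filter_upwards [hw'] with x hx
        rw [hx]; ring
      rw [(h2.sub hw).hsNormSq_congr h3, (hw.excess hk.le).hsNormSq_const_mul]
      simp

theorem indicator_excess {k : ℝ} (hk : 0 ≤ k) (Ω : Set (E d)) (w : E d → ℝ) :
    excess k (Ω.indicator w) = Ω.indicator (excess k w) := by
  ext x
  by_cases hx : x ∈ Ω
  · simp [excess, hx]
  · simp [excess, hx, hk]

/-- For `k ≥ 0` truncation commutes with extension by zero, so the argument runs on all of `ℝ^d`,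
where measure density is trivial and no boundary regularity is used. -/
theorem hasTruncation_tilde (hd : 1 ≤ d) (hs0 : 0 < s) (hs1 : s < 1)
    (hΩ : MeasurableSet Ω) {w : E d → ℝ} (hw : MemHsTilde s Ω w) :
    (FracSpace.tilde : FracSpace Ω).HasTruncation s w := by
  have hD := hasMeasureDensity_univ d
  have hc := hD.1
  have hf := fracConst_pos hd hs0 hs1
  have hcongr : ∀ {g g' : E d → ℝ}, g =ᵐ[volume.restrict Ω] g' →
      Ω.indicator g =ᵐ[volume.restrict univ] Ω.indicator g' := fun h => by
    rw [Measure.restrict_univ]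
    exact (ae_eq_restrict_iff_indicator_ae_eq hΩ).1 h
  refine ⟨(2 / unitBallVolume d) ^ (1 + 2 * s / d) * (2 / fracConst d s), unitBallVolume d / 2,
    by positivity, by positivity, fun k hk => ⟨hsNormSq s univ (excess k (Ω.indicator w)), ?_,
    fun a ha0 ha h => ?_, fun t ht0 ht1 w' hw' => ?_⟩⟩
  · exact (MemHs.excess hw hk.le).hsNormSq_nonneg hd hs0 hs1
  · have h1 := hD.integral_sq_le_hsNormSq MeasurableSet.univ hd hs0 hs1 (MemHs.excess hw hk.le)
      ha0 (by
        refine le_trans (measure_mono fun x hx => ?_) h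
        have hx2 : excess k (Ω.indicator w) x ≠ 0 := hx.2
        rw [indicator_excess hk.le] at hx2
        have hxΩ := mem_of_indicator_ne_zero hx2
        rw [indicator_of_mem hxΩ] at hx2
        exact ⟨hxΩ, hx2⟩) (by rw [div_le_iff₀ hc]; simp; linarith)
    refine le_trans (le_of_eq ?_) h1
    rw [setIntegral_univ, ← integral_indicator hΩ, indicator_excess hk.le]
    congr 1
    ext x
    by_cases hx : x ∈ Ω <;> simp [hx]
  · have hlin : Ω.indicator (fun x => w x - t * excess k w x)
        = fun x => Ω.indicator w x - t * excess k (Ω.indicator w) x := by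
      rw [indicator_excess hk.le]
      ext x
      by_cases hx : x ∈ Ω <;> simp [hx]
    have hw'' := hcongr hw'
    rw [hlin] at hw''
    have h1 := MemHs.sub hw ((MemHs.excess hw hk.le).const_mul t)
    have h2 := h1.congr hw''.symm
    refine ⟨h2, ?_, ?_⟩
    · change hsNormSq s univ (Ω.indicator w') ≤ hsNormSq s univ (Ω.indicator w) - _ + _
      rw [h2.hsNormSq_congr hw'']
      exact MemHs.hsNormSq_sub_excess_le hd hs0 hs1 hw hk.le ht0
    · change hsNormSq s univ (Ω.indicator fun x => w' x - w x) ≤ _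
      have h3 : (fun x => Ω.indicator w' x - Ω.indicator w x) =ᵐ[volume.restrict univ]
          fun x => (-t) * excess k (Ω.indicator w) x := by
        filter_upwards [hw''] with x hx
        rw [hx]; ring
      have h4 : (Ω.indicator fun x => w' x - w x)
          = fun x => Ω.indicator w' x - Ω.indicator w x := by
        ext x
        by_cases hx : x ∈ Ω <;> simp [hx]
      rw [h4, (h2.sub hw).hsNormSq_congr h3, (MemHs.excess hw hk.le).hsNormSq_const_mul]
      simp

end SparseFrac

namespace SparseFrac

variable {d : ℕ} {s : ℝ} {Ω D : Set (E d)} {w v : E d → ℝ}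

/-! ### Test functions belong to `H^s` -/

theorem IsTestFunction.add {ψ χ : E d → ℝ} (hψ : IsTestFunction Ω ψ) (hχ : IsTestFunction Ω χ) :
    IsTestFunction Ω (fun x => ψ x + χ x) :=
  ⟨hψ.1.add hχ.1, hψ.2.1.add hχ.2.1,
    (tsupport_add ψ χ).trans (union_subset hψ.2.2 hχ.2.2)⟩

theorem IsTestFunction.const_mul {ψ : E d → ℝ} (hψ : IsTestFunction Ω ψ) (c : ℝ) :
    IsTestFunction Ω (fun x => c * ψ x) :=
  ⟨contDiff_const.mul hψ.1, hψ.2.1.mul_left,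
    (tsupport_mul_subset_right (f := fun _ => c) (g := ψ)).trans hψ.2.2⟩

theorem isTestFunction_zero : IsTestFunction Ω (fun _ => 0) :=
  ⟨contDiff_const, HasCompactSupport.zero, by simp [tsupport]⟩

theorem IsTestFunction.memLp {ψ : E d → ℝ} (hψ : IsTestFunction Ω ψ) (μ : Measure (E d))
    [IsFiniteMeasureOnCompacts μ] : MemLp ψ 2 μ :=
  hψ.1.continuous.memLp_of_hasCompactSupport hψ.2.1

/-- In polar coordinates the radial exponent is `(d - 1) + (2 - d - 2s) = 1 - 2s`, which exceeds
`-1` exactly when `s < 1`. -/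
theorem integrableOn_norm_rpow_ball (hd : 1 ≤ d) (hs1 : s < 1) {R : ℝ} (hR : 0 < R) :
    IntegrableOn (fun z : E d => ‖z‖ ^ (2 - (d : ℝ) - 2 * s)) (Metric.ball 0 R) volume := by
  have : Nontrivial (E d) := by
    have : Nonempty (Fin d) := ⟨⟨0, hd⟩⟩
    infer_instance
  rw [integrableOn_fun_norm_addHaar volume (f := fun y : ℝ => y ^ (2 - (d : ℝ) - 2 * s))]
  have h : IntegrableOn (fun y : ℝ => y ^ (1 - 2 * s)) (Ioo 0 R) volume :=
    (intervalIntegral.integrableOn_Ioo_rpow_iff hR).2 (by linarith)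
  refine h.congr_fun (fun y hy => ?_) measurableSet_Ioo
  have hy0 : 0 < y := hy.1
  simp only [smul_eq_mul, finrank_euclideanSpace, Fintype.card_fin]
  rw [← Real.rpow_natCast, ← Real.rpow_add hy0]
  congr 1
  push_cast [hd]
  ring

/-- The Gagliardo integrand is at most `K² ‖x - y‖^{2-d-2s}`, a kernel integrable on bounded sets.
-/
theorem memHs_of_lipschitz (hd : 1 ≤ d) (hs1 : s < 1) (hΩ : Bornology.IsBounded Ω)
    (hΩm : MeasurableSet Ω) (hw : MemLp w 2 (volume.restrict Ω)) {K : ℝ}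
    (h : ∀ x y, |w x - w y| ≤ K * ‖x - y‖) : MemHs s Ω w := by
  rw [memHs_iff]
  have hm := aestronglyMeasurable_diffQuot (s := s) hw.1
  refine ⟨hw, (memLp_two_iff_integrable_sq hm).2 ⟨hm.pow 2, ?_⟩⟩
  obtain ⟨R, hR0, hR⟩ : ∃ R : ℝ, 0 < R ∧ ∀ x ∈ Ω, ∀ y ∈ Ω, x - y ∈ Metric.ball (0 : E d) R := by
    obtain ⟨C, hC⟩ := Metric.isBounded_iff.1 hΩ
    refine ⟨|C| + 1, by positivity, fun x hx y hy => ?_⟩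
    rw [mem_ball_zero_iff, ← dist_eq_norm]
    exact (hC hx hy).trans_lt (by linarith [le_abs_self C])
  obtain ⟨h0, hh0⟩ : ∃ h0 : E d → ℝ≥0∞, h0 = (Metric.ball (0 : E d) R).indicator
      (fun z => ENNReal.ofReal (K ^ 2 * ‖z‖ ^ (2 - (d : ℝ) - 2 * s))) := ⟨_, rfl⟩
  have hfin : ∫⁻ z, h0 z < ⊤ := by
    rw [hh0, lintegral_indicator measurableSet_ball]
    have := ((integrableOn_norm_rpow_ball hd hs1 hR0).const_mul (K ^ 2)).lintegral_lt_top
    exact this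
  have hpt : ∀ x y, x ∈ Ω → y ∈ Ω → ‖diffQuot s w (x, y) ^ 2‖ₑ ≤ h0 (x - y) := by
    intro x y hx hy
    rw [hh0, indicator_of_mem (hR x hx y hy), Real.enorm_eq_ofReal (sq_nonneg _)]
    refine ENNReal.ofReal_le_ofReal ?_
    rw [diffQuot_sq]
    rcases eq_or_ne x y with rfl | hxy
    · simp; positivity
    have h1 : 0 < ‖x - y‖ := norm_pos_iff.2 (sub_ne_zero.2 hxy)
    have h2 : |w x - w y| ^ 2 ≤ (K * ‖x - y‖) ^ 2 := by gcongr; exact h x y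
    rw [div_le_iff₀ (by positivity), mul_assoc, ← Real.rpow_add h1]
    refine h2.trans (le_of_eq ?_)
    rw [mul_pow, ← Real.rpow_natCast ‖x - y‖]
    congr 2
    push_cast
    ring
  have hm2 : AEMeasurable (fun z => ‖diffQuot s w z ^ 2‖ₑ)
      ((volume.restrict Ω).prod (volume.restrict Ω)) := (hm.pow 2).enorm
  rw [HasFiniteIntegral, lintegral_prod _ hm2]
  calc ∫⁻ x in Ω, ∫⁻ y in Ω, ‖diffQuot s w (x, y) ^ 2‖ₑ
      ≤ ∫⁻ x in Ω, ∫⁻ z, h0 z := by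
        refine setLIntegral_mono' hΩm fun x hx => ?_
        calc _ ≤ ∫⁻ y in Ω, h0 (x - y) := setLIntegral_mono' hΩm fun y hy => hpt x y hx hy
          _ ≤ ∫⁻ y, h0 (x - y) := setLIntegral_le_lintegral _ _
          _ = _ := lintegral_sub_left_eq_self _ _
    _ < ⊤ := by
        rw [setLIntegral_const]
        exact ENNReal.mul_lt_top hfin hΩ.measure_lt_top

theorem IsTestFunction.memHs (hd : 1 ≤ d) (hs1 : s < 1) (hΩ : Bornology.IsBounded Ω)
    (hΩm : MeasurableSet Ω) {ψ : E d → ℝ} (hψ : IsTestFunction Ω ψ) : MemHs s Ω ψ := by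
  obtain ⟨K, hK⟩ := hψ.1.lipschitzWith_of_hasCompactSupport hψ.2.1 (by simp)
  refine memHs_of_lipschitz hd hs1 hΩ hΩm (hψ.memLp _) (K := K) fun x y => ?_
  have := hK.dist_le_mul x y
  rwa [Real.dist_eq, dist_eq_norm] at this

/-! ### Convergence of truncations -/

/-- A generalized dominated convergence theorem: the majorants `Fn` vary but converge in `L²`. It is
applied to the functions and to their difference quotients. -/
theorem tendsto_integral_sq_of_dominated {α : Type*} [MeasurableSpace α] {μ : Measure α}
    {F G : α → ℝ} {Fn Gn : ℕ → α → ℝ} (hF : MemLp F 2 μ) (hG : MemLp G 2 μ)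
    (hFn : ∀ n, MemLp (Fn n) 2 μ) (hGn : ∀ n, MemLp (Gn n) 2 μ)
    (hGF : ∀ x, |G x| ≤ |F x|) (hGFn : ∀ n x, |Gn n x| ≤ |Fn n x|)
    (hae : ∀ᵐ x ∂μ, Tendsto (fun n => Gn n x) atTop (𝓝 (G x)))
    (hlim : Tendsto (fun n => ∫ x, (F x - Fn n x) ^ 2 ∂μ) atTop (𝓝 0)) :
    Tendsto (fun n => ∫ x, (G x - Gn n x) ^ 2 ∂μ) atTop (𝓝 0) := by
  -- Subtracting `|F - Fn|` leaves a remainder dominated by the fixed function `2|F|`, so ordinary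
  -- dominated convergence applies to it.
  obtain ⟨H, hH⟩ : ∃ H : ℕ → α → ℝ,
    H = fun n x => max (|G x - Gn n x| - |F x - Fn n x|) 0 := ⟨_, rfl⟩
  have hHle : ∀ n x, H n x ≤ 2 * |F x| := by
    intro n x
    rw [hH]
    refine max_le ?_ (by positivity)
    have h1 := abs_sub (G x) (Gn n x)
    have h2 := abs_sub_abs_le_abs_sub (Fn n x) (F x)
    rw [abs_sub_comm (Fn n x)] at h2
    linarith [hGF x, hGFn n x]
  have hH0 : ∀ n x, 0 ≤ H n x := fun n x => by rw [hH]; exact le_max_right _ _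
  have hHm : ∀ n, AEStronglyMeasurable (H n) μ := fun n => by
    rw [hH]
    exact ((hG.1.sub (hGn n).1).norm.sub (hF.1.sub (hFn n).1).norm).sup
      aestronglyMeasurable_const
  have hHlim : Tendsto (fun n => ∫ x, H n x ^ 2 ∂μ) atTop (𝓝 0) := by
    have h := tendsto_integral_of_dominated_convergence (μ := μ) (F := fun n x => H n x ^ 2)
      (f := fun _ => 0) (fun x => 4 * F x ^ 2) (fun n => (hHm n).pow 2)
      (hF.integrable_sq.const_mul 4) (fun n => ae_of_all _ fun x => ?_) ?_
    · simpa using h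
    · rw [Real.norm_of_nonneg (sq_nonneg _)]
      calc H n x ^ 2 ≤ (2 * |F x|) ^ 2 := by
            have := hH0 n x
            gcongr
            exact hHle n x
        _ = _ := by rw [mul_pow, sq_abs]; norm_num
    · filter_upwards [hae] with x hx
      have h1 : Tendsto (fun n => |G x - Gn n x|) atTop (𝓝 0) := by
        simpa using ((tendsto_const_nhds (x := G x)).sub hx).abs
      have h2 : Tendsto (fun n => H n x) atTop (𝓝 0) := by
        refine squeeze_zero (fun n => hH0 n x) (fun n => ?_) h1
        rw [hH]
        exact max_le (by linarith [abs_nonneg (F x - Fn n x)]) (abs_nonneg _)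
      simpa using h2.pow 2
  have hbd : Tendsto (fun n => 2 * ∫ x, H n x ^ 2 ∂μ + 2 * ∫ x, (F x - Fn n x) ^ 2 ∂μ) atTop
      (𝓝 0) := by
    simpa using (hHlim.const_mul 2).add (hlim.const_mul 2)
  refine squeeze_zero (fun n => integral_nonneg fun x => sq_nonneg _) (fun n => ?_) hbd
  have hH2 : MemLp (H n) 2 μ := (hF.const_mul 2).mono (hHm n) (ae_of_all _ fun x => by
    rw [Real.norm_of_nonneg (hH0 n x)]
    refine (hHle n x).trans (le_of_eq ?_)
    simp)
  have h1 := hH2.integrable_sq.const_mul 2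
  have h2 : Integrable (fun x => 2 * (F x - Fn n x) ^ 2) μ :=
    (hF.sub (hFn n)).integrable_sq.const_mul 2
  rw [← integral_const_mul, ← integral_const_mul, ← integral_add h1 h2]
  refine integral_mono (hG.sub (hGn n)).integrable_sq (h1.add h2) fun x => ?_
  have h3 : |G x - Gn n x| ≤ H n x + |F x - Fn n x| := by
    rw [hH]
    linarith [le_max_left (|G x - Gn n x| - |F x - Fn n x|) 0]
  have h4 : |G x - Gn n x| ^ 2 ≤ (H n x + |F x - Fn n x|) ^ 2 := by gcongr
  rw [sq_abs] at h4
  nlinarith [sq_abs (F x - Fn n x), sq_nonneg (H n x - |F x - Fn n x|)]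

theorem eLpNorm_two_eq_sqrt {α : Type*} [MeasurableSpace α] {μ : Measure α} {f : α → ℝ}
    (hf : MemLp f 2 μ) : eLpNorm f 2 μ = ENNReal.ofReal (√(∫ x, f x ^ 2 ∂μ)) := by
  rw [hf.eLpNorm_eq_integral_rpow_norm two_ne_zero ENNReal.ofNat_ne_top, Real.sqrt_eq_rpow]
  simp

theorem exists_subseq_tendsto_ae {α : Type*} [MeasurableSpace α] {μ : Measure α}
    {F : α → ℝ} {Fn : ℕ → α → ℝ} (hF : MemLp F 2 μ) (hFn : ∀ n, MemLp (Fn n) 2 μ)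
    (hlim : Tendsto (fun n => ∫ x, (F x - Fn n x) ^ 2 ∂μ) atTop (𝓝 0)) :
    ∃ ns : ℕ → ℕ, StrictMono ns ∧
      ∀ᵐ x ∂μ, Tendsto (fun n => Fn (ns n) x) atTop (𝓝 (F x)) := by
  refine TendstoInMeasure.exists_seq_tendsto_ae (tendstoInMeasure_of_tendsto_eLpNorm two_ne_zero
    (fun n => (hFn n).1) hF.1 ?_)
  have h : ∀ n, eLpNorm (Fn n - F) 2 μ = ENNReal.ofReal (√(∫ x, (F x - Fn n x) ^ 2 ∂μ)) := by
    intro n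
    rw [← eLpNorm_neg, neg_sub]
    exact eLpNorm_two_eq_sqrt (hF.sub (hFn n))
  simp only [h]
  simpa using ENNReal.tendsto_ofReal hlim.sqrt

/-! ### Truncation in `H^s_0` -/

theorem tendsto_hsNormSq_iff (hd : 1 ≤ d) (hs0 : 0 < s) (hs1 : s < 1) {f : ℕ → E d → ℝ}
    (hf : ∀ n, MemHs s D (f n)) :
    Tendsto (fun n => hsNormSq s D (f n)) atTop (𝓝 0) ↔
      Tendsto (fun n => ∫ x in D, f n x ^ 2) atTop (𝓝 0) ∧
      Tendsto (fun n => ∫ z, diffQuot s (f n) z ^ 2 ∂(volume.restrict D).prod (volume.restrict D))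
        atTop (𝓝 0) := by
  have hc := fracConst_pos hd hs0 hs1
  have h1 : ∀ n, 0 ≤ ∫ x in D, f n x ^ 2 := fun n => integral_nonneg fun x => sq_nonneg _
  have h2 : ∀ n, 0 ≤ ∫ z, diffQuot s (f n) z ^ 2 ∂(volume.restrict D).prod (volume.restrict D) :=
    fun n => integral_nonneg fun x => sq_nonneg _
  have heq := fun n => (hf n).hsNormSq_eq
  constructor
  · intro h
    refine ⟨squeeze_zero h1 (fun n => ?_) h, squeeze_zero h2 (fun n => ?_)
      (by simpa using h.const_mul (2 / fracConst d s))⟩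
    · rw [heq]
      have := h2 n
      have : 0 ≤ fracConst d s / 2 * ∫ z, diffQuot s (f n) z ^ 2 ∂(volume.restrict D).prod
        (volume.restrict D) := by positivity
      linarith
    · rw [heq, div_mul_eq_mul_div, le_div_iff₀ hc]
      linarith [h1 n]
  · rintro ⟨ha, hb⟩
    simp only [heq]
    simpa using ha.add (hb.const_mul (fracConst d s / 2))

theorem memHs0_iff : MemHs0 s Ω w ↔ MemHs s Ω w ∧ ∃ ψ : ℕ → E d → ℝ,
    (∀ n, IsTestFunction Ω (ψ n)) ∧
      Tendsto (fun n => √(hsNormSq s Ω (fun x => w x - ψ n x))) atTop (𝓝 0) := by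
  refine and_congr_right fun hw => ⟨fun h => ?_, fun ⟨ψ, hψ, hlim⟩ ε hε => ?_⟩
  · choose ψ hψ using fun n : ℕ => h (1 / (n + 1)) (by positivity)
    exact ⟨ψ, fun n => (hψ n).1, squeeze_zero (fun n => Real.sqrt_nonneg _)
      (fun n => (hψ n).2.le) tendsto_one_div_add_atTop_nhds_zero_nat⟩
  · obtain ⟨n, hn⟩ := (hlim.eventually (gt_mem_nhds hε)).exists
    exact ⟨ψ n, hψ n, hn⟩

theorem memHs0_iff_tendsto (hd : 1 ≤ d) (hs0 : 0 < s) (hs1 : s < 1) (hΩ : Bornology.IsBounded Ω)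
    (hΩm : MeasurableSet Ω) : MemHs0 s Ω w ↔ MemHs s Ω w ∧ ∃ ψ : ℕ → E d → ℝ,
    (∀ n, IsTestFunction Ω (ψ n)) ∧
      Tendsto (fun n => ∫ x in Ω, (w x - ψ n x) ^ 2) atTop (𝓝 0) ∧
      Tendsto (fun n => ∫ z, (diffQuot s w z - diffQuot s (ψ n) z) ^ 2
        ∂(volume.restrict Ω).prod (volume.restrict Ω)) atTop (𝓝 0) := by
  rw [memHs0_iff]
  refine and_congr_right fun hw => exists_congr fun ψ => and_congr_right fun hψ => ?_
  have hm : ∀ n, MemHs s Ω (fun x => w x - ψ n x) := fun n =>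
    hw.sub ((hψ n).memHs hd hs1 hΩ hΩm)
  have h := tendsto_hsNormSq_iff hd hs0 hs1 hm
  simp only [diffQuot_sub] at h
  rw [← h]
  constructor
  · intro h1
    have h2 := h1.pow 2
    simpa [Real.sq_sqrt ((hm _).hsNormSq_nonneg hd hs0 hs1)] using h2
  · intro h1
    simpa using h1.sqrt

theorem tendsto_integral_add_sq {α : Type*} [MeasurableSpace α] {μ : Measure α}
    {f g : ℕ → α → ℝ} (hf : ∀ n, MemLp (f n) 2 μ) (hg : ∀ n, MemLp (g n) 2 μ) (a b : ℝ)
    (hf0 : Tendsto (fun n => ∫ x, f n x ^ 2 ∂μ) atTop (𝓝 0))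
    (hg0 : Tendsto (fun n => ∫ x, g n x ^ 2 ∂μ) atTop (𝓝 0)) :
    Tendsto (fun n => ∫ x, (a * f n x + b * g n x) ^ 2 ∂μ) atTop (𝓝 0) := by
  have hbd : Tendsto (fun n => 2 * a ^ 2 * ∫ x, f n x ^ 2 ∂μ + 2 * b ^ 2 * ∫ x, g n x ^ 2 ∂μ)
      atTop (𝓝 0) := by
    simpa using (hf0.const_mul (2 * a ^ 2)).add (hg0.const_mul (2 * b ^ 2))
  refine squeeze_zero (fun n => integral_nonneg fun x => sq_nonneg _) (fun n => ?_) hbd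
  have h1 := (hf n).integrable_sq.const_mul (2 * a ^ 2)
  have h2 := (hg n).integrable_sq.const_mul (2 * b ^ 2)
  rw [← integral_const_mul, ← integral_const_mul, ← integral_add h1 h2]
  refine integral_mono (((hf n).const_mul a).add ((hg n).const_mul b)).integrable_sq
    (h1.add h2) fun x => ?_
  change (a * f n x + b * g n x) ^ 2 ≤ 2 * a ^ 2 * f n x ^ 2 + 2 * b ^ 2 * g n x ^ 2
  nlinarith [sq_nonneg (a * f n x - b * g n x)]

theorem MemHs0.linear_comb (hd : 1 ≤ d) (hs0 : 0 < s) (hs1 : s < 1) (hΩ : Bornology.IsBounded Ω)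
    (hΩm : MeasurableSet Ω) (hw : MemHs0 s Ω w) (hv : MemHs0 s Ω v) (a b : ℝ) :
    MemHs0 s Ω (fun x => a * w x + b * v x) := by
  rw [memHs0_iff_tendsto hd hs0 hs1 hΩ hΩm] at hw hv ⊢
  obtain ⟨hw, ψ, hψ, h1, h2⟩ := hw
  obtain ⟨hv, χ, hχ, h3, h4⟩ := hv
  have hwL := memHs_iff.1 hw
  have hvL := memHs_iff.1 hv
  have hψL := fun n => memHs_iff.1 ((hψ n).memHs hd hs1 hΩ hΩm)
  have hχL := fun n => memHs_iff.1 ((hχ n).memHs hd hs1 hΩ hΩm)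
  have hdq : ∀ f g : E d → ℝ, ∀ z, diffQuot s (fun x => a * f x + b * g x) z
      = a * diffQuot s f z + b * diffQuot s g z := fun f g z => by unfold diffQuot; ring
  refine ⟨?_, fun n x => a * ψ n x + b * χ n x, fun n => ((hψ n).const_mul a).add
    ((hχ n).const_mul b), ?_, ?_⟩
  · have h : (fun x => a * w x + b * v x) = fun x => a * w x - (-b) * v x := by ext x; ring
    rw [h]
    exact (hw.const_mul a).sub (hv.const_mul (-b))
  · refine (tendsto_integral_add_sq (fun n => hwL.1.sub (hψL n).1) (fun n => hvL.1.sub (hχL n).1)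
      a b h1 h3).congr fun n => integral_congr_ae (ae_of_all _ fun x => ?_)
    simp only [Pi.sub_apply]; ring
  · refine (tendsto_integral_add_sq (fun n => hwL.2.sub (hψL n).2) (fun n => hvL.2.sub (hχL n).2)
      a b h2 h4).congr fun n => integral_congr_ae (ae_of_all _ fun x => ?_)
    simp only [Pi.sub_apply, hdq]; ring

/-- If test functions `ψ n` approximate `w`, then smooth truncations of a subsequence converging
almost everywhere approximate `min w k`. Contractions do not increase difference quotients, so those
of the `ψ n` serve as majorants. -/
theorem MemHs0.min_const (hd : 1 ≤ d) (hs0 : 0 < s) (hs1 : s < 1) (hΩ : Bornology.IsBounded Ω)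
    (hΩm : MeasurableSet Ω) (hw : MemHs0 s Ω w) {k : ℝ} (hk : 0 ≤ k) :
    MemHs0 s Ω (fun x => min (w x) k) := by
  rw [memHs0_iff_tendsto hd hs0 hs1 hΩ hΩm] at hw ⊢
  obtain ⟨hw, ψ, hψ, h1, h2⟩ := hw
  have hmin : ∀ a b : ℝ, |min a k - min b k| ≤ |a - b| := fun a b => by
    simpa using abs_min_sub_min_le_max a k b k
  have hm : MemHs s Ω (fun x => min (w x) k) :=
    hw.comp_contraction (G := fun a => min a k) hmin (by simpa using hk)
  have hwL := memHs_iff.1 hw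
  have hmL := memHs_iff.1 hm
  obtain ⟨ns, hns, hae⟩ := exists_subseq_tendsto_ae hwL.1 (fun n => (hψ n).memLp _) h1
  have hε : ∀ n : ℕ, (0 : ℝ) < 1 / (n + 1) := fun n => by positivity
  have hχ : ∀ n : ℕ, IsTestFunction Ω (fun x => smoothMin k (1 / ((n : ℝ) + 1)) (ψ (ns n) x)) :=
    fun n => (hψ (ns n)).smoothMin_comp k (hε n)
  have hψL := fun n => memHs_iff.1 ((hψ n).memHs (s := s) hd hs1 hΩ hΩm)
  have hχL := fun n => memHs_iff.1 ((hχ n).memHs (s := s) hd hs1 hΩ hΩm)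
  have hlim : ∀ x, Tendsto (fun n => ψ (ns n) x) atTop (𝓝 (w x)) →
      Tendsto (fun n : ℕ => smoothMin k (1 / ((n : ℝ) + 1)) (ψ (ns n) x)) atTop
        (𝓝 (min (w x) k)) := by
    intro x hx
    rw [tendsto_iff_dist_tendsto_zero] at hx ⊢
    have h3 : Tendsto (fun n : ℕ => 1 / ((n : ℝ) + 1) + dist (ψ (ns n) x) (w x)) atTop (𝓝 0) := by
      simpa using tendsto_one_div_add_atTop_nhds_zero_nat.add hx
    refine squeeze_zero (fun n => dist_nonneg) (fun n => ?_) h3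
    have h4 := abs_smoothMin_sub_min_le hk (hε n).le (ψ (ns n) x)
    exact (dist_triangle _ (min (ψ (ns n) x) k) _).trans (add_le_add h4 (hmin _ _))
  refine ⟨hm, fun n x => smoothMin k (1 / ((n : ℝ) + 1)) (ψ (ns n) x), hχ, ?_, ?_⟩
  · refine tendsto_integral_sq_of_dominated hwL.1 hmL.1 (fun n => (hψL (ns n)).1)
      (fun n => (hχL n).1) (fun x => ?_) (fun n x => ?_) (hae.mono fun x => hlim x)
      (h1.comp hns.tendsto_atTop)
    · simpa [hk] using hmin (w x) 0
    · simpa using abs_smoothMin_sub_le k (1 / ((n : ℝ) + 1)) (ψ (ns n) x) 0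
  · refine tendsto_integral_sq_of_dominated hwL.2 hmL.2 (fun n => (hψL (ns n)).2)
      (fun n => (hχL n).2) (fun z => abs_diffQuot_le hmin w z)
      (fun n z => abs_diffQuot_le (abs_smoothMin_sub_le k _) (ψ (ns n)) z) ?_
      (h2.comp hns.tendsto_atTop)
    filter_upwards [Measure.quasiMeasurePreserving_fst.ae hae,
      Measure.quasiMeasurePreserving_snd.ae hae] with z hz1 hz2
    exact ((hlim _ hz1).sub (hlim _ hz2)).div_const _

/-- The norm estimates are those of `H^s`; only membership is new, and it follows because `w - t (w
- k)^+` is the convex combination `(1 - t) w + t min w k`. -/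
theorem hasTruncation_zero (hd : 1 ≤ d) (hs0 : 0 < s) (hs1 : s < 1)
    (hΩ : IsBoundedLipschitzDomain Ω) (hw : MemHs0 s Ω w) :
    (FracSpace.zero : FracSpace Ω).HasTruncation s w := by
  obtain ⟨C, a₀, hC, ha₀, H⟩ := hasTruncation_full hd hs0 hs1 hΩ hw.1
  refine ⟨C, a₀, hC, ha₀, fun k hk => ?_⟩
  obtain ⟨Q, hQ, h1, h2⟩ := H k hk
  refine ⟨Q, hQ, h1, fun t ht0 ht1 w' hw' => ⟨?_, (h2 t ht0 ht1 w' hw').2⟩⟩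
  have hmeas := hΩ.isOpen.measurableSet
  have h3 := hw.linear_comb hd hs0 hs1 hΩ.isBounded hmeas
    (hw.min_const hd hs0 hs1 hΩ.isBounded hmeas hk.le) (1 - t) t
  have h4 : w' =ᵐ[volume.restrict Ω] fun x => (1 - t) * w x + t * min (w x) k := by
    filter_upwards [hw'] with x hx
    rw [hx, ← sub_excess k w x]
    ring
  have h5 : MemHs s Ω w' := h3.1.congr h4.symm
  refine ⟨h5, fun ε hε => ?_⟩
  obtain ⟨ψ, hψ, hlt⟩ := h3.2 ε hε
  refine ⟨ψ, hψ, ?_⟩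
  have h6 : (fun x => w' x - ψ x) =ᵐ[volume.restrict Ω]
      fun x => (1 - t) * w x + t * min (w x) k - ψ x := h4.mono fun x hx => by simp only [hx]
  rwa [(h5.sub (hψ.memHs hd hs1 hΩ.isBounded hmeas)).hsNormSq_congr h6]

end SparseFrac

namespace SparseFrac

/-! ### Eigenbases of closed forms and their Yosida approximations -/

section Hilbert

variable {X Y : Type*} [NormedAddCommGroup X] [InnerProductSpace ℝ X] [NormedAddCommGroup Y]
  [InnerProductSpace ℝ Y] {Γ : Submodule ℝ (X × Y)} {φ : HilbertBasis ℕ ℝ X} {lam : ℕ → ℝ}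
  {G : ℕ → Y}

/-- `φ` is an orthonormal basis of eigenvectors, with "gradients" `G` and eigenvalues `lam`,
for the quadratic form `‖b‖²`, `(a, b) ∈ Γ`. -/
structure IsEigenGraph (Γ : Submodule ℝ (X × Y)) (φ : HilbertBasis ℕ ℝ X) (lam : ℕ → ℝ)
    (G : ℕ → Y) : Prop where
  mem : ∀ n, (φ n, G n) ∈ Γ.topologicalClosure
  inner_eq : ∀ n, ∀ z ∈ Γ, inner ℝ (G n) z.2 = lam n * inner ℝ (φ n) z.1

theorem IsEigenGraph.inner_eq_closure (h : IsEigenGraph Γ φ lam G) (n : ℕ) {z : X × Y}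
    (hz : z ∈ Γ.topologicalClosure) : inner ℝ (G n) z.2 = lam n * inner ℝ (φ n) z.1 := by
  have hcl : IsClosed {z : X × Y | inner ℝ (G n) z.2 = lam n * inner ℝ (φ n) z.1} :=
    isClosed_eq (by fun_prop) (by fun_prop)
  have hsub : closure (Γ : Set (X × Y)) ⊆ {z | inner ℝ (G n) z.2 = lam n * inner ℝ (φ n) z.1} :=
    closure_minimal (fun z hz => h.inner_eq n z hz) hcl
  exact hsub hz

theorem IsEigenGraph.sum_mem (h : IsEigenGraph Γ φ lam G) (F : Finset ℕ) (c : ℕ → ℝ) :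
    (∑ n ∈ F, c n • φ n, ∑ n ∈ F, c n • G n) ∈ Γ.topologicalClosure := by
  have h1 : (∑ n ∈ F, c n • φ n, ∑ n ∈ F, c n • G n) = ∑ n ∈ F, c n • ((φ n, G n) : X × Y) := by
    ext <;> simp [Prod.fst_sum, Prod.snd_sum]
  rw [h1]
  exact Submodule.sum_mem _ fun n _ => Submodule.smul_mem _ (c n) (h.mem n)

theorem IsEigenGraph.norm_sum_sq (h : IsEigenGraph Γ φ lam G) (F : Finset ℕ) (c : ℕ → ℝ) :
    ‖∑ n ∈ F, c n • G n‖ ^ 2 = ∑ n ∈ F, lam n * c n ^ 2 := by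
  rw [← real_inner_self_eq_norm_sq]
  nth_rw 1 [sum_inner]
  refine Finset.sum_congr rfl fun n hn => ?_
  rw [inner_smul_left, h.inner_eq_closure n (h.sum_mem F c), φ.orthonormal.inner_right_sum c hn]
  simp; ring

theorem IsEigenGraph.lam_nonneg (h : IsEigenGraph Γ φ lam G) (n : ℕ) : 0 ≤ lam n := by
  have h1 := h.inner_eq_closure n (h.mem n)
  simp only [real_inner_self_eq_norm_sq, φ.orthonormal.1 n] at h1
  have := sq_nonneg ‖G n‖
  linarith

/-- Bessel's inequality for gradients: the `G n` are orthogonal with squared norms `lam n`. -/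
theorem IsEigenGraph.sum_lam_mul_sq_le (h : IsEigenGraph Γ φ lam G) {z : X × Y} (hz : z ∈ Γ)
    (F : Finset ℕ) : ∑ n ∈ F, lam n * inner ℝ (φ n) z.1 ^ 2 ≤ ‖z.2‖ ^ 2 := by
  have h1 := sq_nonneg ‖z.2 - ∑ n ∈ F, (inner ℝ (φ n) z.1 : ℝ) • G n‖
  rw [norm_sub_sq_real, h.norm_sum_sq, inner_sum] at h1
  have h2 : ∀ n ∈ F, inner ℝ z.2 ((inner ℝ (φ n) z.1 : ℝ) • G n)
      = lam n * inner ℝ (φ n) z.1 ^ 2 := fun n _ => by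
    rw [inner_smul_right, real_inner_comm (G n), h.inner_eq n z hz]; ring
  rw [Finset.sum_congr rfl h2] at h1
  linarith

/-- The quadratic form `∑ μ λ_n / (λ_n + μ) x_n²`. -/
noncomputable def yosidaForm (φ : HilbertBasis ℕ ℝ X) (lam : ℕ → ℝ) (μ : ℝ) (x : X) : ℝ :=
  ∑' n, μ * lam n / (lam n + μ) * inner ℝ (φ n) x ^ 2

theorem hasSum_inner_sq (φ : HilbertBasis ℕ ℝ X) (x : X) :
    HasSum (fun n => inner ℝ (φ n) x ^ 2) (‖x‖ ^ 2) := by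
  have h := φ.hasSum_inner_mul_inner x x
  rw [real_inner_self_eq_norm_sq] at h
  refine h.congr_fun fun n => ?_
  rw [real_inner_comm x, pow_two]

theorem IsEigenGraph.summable_yosida (h : IsEigenGraph Γ φ lam G) {μ : ℝ} (hμ : 0 < μ) (x : X) :
    Summable fun n => μ * lam n / (lam n + μ) * inner ℝ (φ n) x ^ 2 := by
  refine Summable.of_nonneg_of_le (fun n => ?_) (fun n => ?_)
    ((hasSum_inner_sq φ x).summable.mul_left μ)
  · have := h.lam_nonneg n
    positivity
  · have := h.lam_nonneg n
    gcongr
    rw [div_le_iff₀ (by positivity)]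
    nlinarith [sq_nonneg μ]

/-- Termwise, `μλ/(λ + μ) a²` is the minimum over `b` of `μ(a - b)² + λ b²`; then Bessel's
inequality is applied in both spaces. -/
theorem IsEigenGraph.yosidaForm_le (h : IsEigenGraph Γ φ lam G) {μ : ℝ} (hμ : 0 < μ) (x : X)
    {z : X × Y} (hz : z ∈ Γ) : yosidaForm φ lam μ x ≤ μ * ‖x - z.1‖ ^ 2 + ‖z.2‖ ^ 2 := by
  refine (h.summable_yosida hμ x).tsum_le_of_sum_le fun F => ?_
  have h1 := φ.orthonormal.sum_inner_products_le (x - z.1) (s := F)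
  have h2 := h.sum_lam_mul_sq_le hz F
  have h3 := mul_le_mul_of_nonneg_left h1 hμ.le
  refine le_trans ?_ (add_le_add h3 h2)
  rw [Finset.mul_sum, ← Finset.sum_add_distrib]
  refine Finset.sum_le_sum fun n _ => ?_
  have hl := h.lam_nonneg n
  rw [inner_sub_right, Real.norm_eq_abs, sq_abs, div_mul_eq_mul_div, div_le_iff₀ (by positivity)]
  obtain ⟨a, ha⟩ : ∃ a : ℝ, a = inner ℝ (φ n) x := ⟨_, rfl⟩
  obtain ⟨b, hb⟩ : ∃ b : ℝ, b = inner ℝ (φ n) z.1 := ⟨_, rfl⟩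
  rw [← ha, ← hb]
  nlinarith [sq_nonneg (μ * (a - b) - lam n * b)]

/-- With the preceding bound, this makes the Yosida form an infimum over `Γ`. Partial eigenfunction
sums are nearly optimal; they lie in the closure of `Γ`, and the functional is continuous. -/
theorem IsEigenGraph.exists_lt_yosidaForm_add (h : IsEigenGraph Γ φ lam G) {μ : ℝ} (hμ : 0 < μ)
    (x : X) {ε : ℝ} (hε : 0 < ε) :
    ∃ z ∈ Γ, μ * ‖x - z.1‖ ^ 2 + ‖z.2‖ ^ 2 < yosidaForm φ lam μ x + ε := by
  -- The termwise minimizers, i.e. the coefficients of `μ (λ + μ)⁻¹ x`.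
  obtain ⟨θ, hθ⟩ : ∃ θ : ℕ → ℝ, θ = fun n => μ / (lam n + μ) * inner ℝ (φ n) x := ⟨_, rfl⟩
  have hJ : ∀ F : Finset ℕ, μ * ‖x - ∑ n ∈ F, θ n • φ n‖ ^ 2 + ‖∑ n ∈ F, θ n • G n‖ ^ 2
      = μ * ‖x‖ ^ 2 - μ * ∑ n ∈ F, inner ℝ (φ n) x ^ 2
        + ∑ n ∈ F, μ * lam n / (lam n + μ) * inner ℝ (φ n) x ^ 2 := by
    intro F
    have h1 : ‖∑ n ∈ F, θ n • φ n‖ ^ 2 = ∑ n ∈ F, θ n ^ 2 := by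
      rw [← real_inner_self_eq_norm_sq]
      nth_rw 1 [sum_inner]
      refine Finset.sum_congr rfl fun n hn => ?_
      rw [inner_smul_left, φ.orthonormal.inner_right_sum θ hn]
      simp; ring
    have h2 : inner ℝ x (∑ n ∈ F, θ n • φ n) = ∑ n ∈ F, θ n * inner ℝ (φ n) x := by
      rw [inner_sum]
      exact Finset.sum_congr rfl fun n _ => by rw [inner_smul_right, real_inner_comm]
    have h3 : ∑ n ∈ F, lam n * θ n ^ 2 - 2 * μ * (∑ n ∈ F, θ n * inner ℝ (φ n) x)
        + μ * (∑ n ∈ F, θ n ^ 2) + μ * ∑ n ∈ F, inner ℝ (φ n) x ^ 2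
        = ∑ n ∈ F, μ * lam n / (lam n + μ) * inner ℝ (φ n) x ^ 2 := by
      simp only [Finset.mul_sum, ← Finset.sum_sub_distrib, ← Finset.sum_add_distrib]
      refine Finset.sum_congr rfl fun n _ => ?_
      have hl := h.lam_nonneg n
      have : lam n + μ ≠ 0 := by positivity
      rw [hθ]
      field_simp
      ring
    rw [h.norm_sum_sq, norm_sub_sq_real, h1, h2]
    linarith
  have hlim : Tendsto (fun F : Finset ℕ => μ * ‖x‖ ^ 2 - μ * ∑ n ∈ F, inner ℝ (φ n) x ^ 2
        + ∑ n ∈ F, μ * lam n / (lam n + μ) * inner ℝ (φ n) x ^ 2) atTop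
      (𝓝 (μ * ‖x‖ ^ 2 - μ * ‖x‖ ^ 2 + yosidaForm φ lam μ x)) :=
    (tendsto_const_nhds.sub ((hasSum_inner_sq φ x).const_mul μ)).add (h.summable_yosida hμ x).hasSum
  rw [sub_self, zero_add] at hlim
  obtain ⟨F, hF⟩ := (hlim.eventually (gt_mem_nhds (lt_add_of_pos_right _ hε))).exists
  rw [← hJ] at hF
  have hopen : IsOpen {z : X × Y | μ * ‖x - z.1‖ ^ 2 + ‖z.2‖ ^ 2 < yosidaForm φ lam μ x + ε} :=
    isOpen_lt (by fun_prop) continuous_const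
  obtain ⟨z, hz1, hz2⟩ := mem_closure_iff.1 (h.sum_mem F θ) _ hopen hF
  exact ⟨z, hz2, hz1⟩

/-- Weighted AM–GM gives `λ^{1-s} μ^s ≤ (1 - s) λ + s μ ≤ λ + μ`, that is, `μλ/(λ + μ) ≤ μ^{1-s}
λ^s`. -/
theorem IsEigenGraph.yosidaForm_le_rpow (h : IsEigenGraph Γ φ lam G) {s : ℝ} (hs0 : 0 < s)
    (hs1 : s < 1) {μ : ℝ} (hμ : 0 < μ) {x : X}
    (hx : Summable fun n => lam n ^ s * inner ℝ (φ n) x ^ 2) :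
    yosidaForm φ lam μ x ≤ μ ^ (1 - s) * ∑' n, lam n ^ s * inner ℝ (φ n) x ^ 2 := by
  rw [← tsum_mul_left]
  refine (h.summable_yosida hμ x).tsum_le_tsum (fun n => ?_) (hx.mul_left _)
  have hl := h.lam_nonneg n
  rw [← mul_assoc]
  gcongr
  rw [div_le_iff₀ (by positivity)]
  have h1 := Real.geom_mean_le_arith_mean2_weighted (w₁ := 1 - s) (w₂ := s) (p₁ := lam n)
    (p₂ := μ) (by linarith) hs0.le hl hμ.le (by ring)
  have h2 : μ * lam n = μ ^ (1 - s) * lam n ^ s * (lam n ^ (1 - s) * μ ^ s) := by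
    have h3 : μ ^ (1 - s) * μ ^ s = μ := by rw [← Real.rpow_add hμ]; simp
    have h4 : lam n ^ s * lam n ^ (1 - s) = lam n := by
      rw [← Real.rpow_add' hl (by simp)]; simp
    calc μ * lam n = (μ ^ (1 - s) * μ ^ s) * (lam n ^ s * lam n ^ (1 - s)) := by rw [h3, h4]
      _ = _ := by ring
  rw [h2]
  gcongr
  refine h1.trans ?_
  nlinarith

/-- A contraction for all Yosida forms is a contraction for the fractional form. -/
theorem IsEigenGraph.rpow_sum_le (h : IsEigenGraph Γ φ lam G) {s : ℝ} (hs0 : 0 < s)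
    (hs1 : s < 1) {x y : X} (hxy : ∀ μ, 0 < μ → yosidaForm φ lam μ y ≤ yosidaForm φ lam μ x)
    (hx : Summable fun n => lam n ^ s * inner ℝ (φ n) x ^ 2) :
    (Summable fun n => lam n ^ s * inner ℝ (φ n) y ^ 2) ∧
      ∑' n, lam n ^ s * inner ℝ (φ n) y ^ 2 ≤ ∑' n, lam n ^ s * inner ℝ (φ n) x ^ 2 := by
  have hs : s ∈ Ioo (0 : ℝ) 1 := ⟨hs0, hs1⟩
  have hlam := h.lam_nonneg
  obtain ⟨C, hC⟩ : ∃ C, C = ∫ t in Ioi 0, Real.rpowIntegrand₀₁ s t 1 := ⟨_, rfl⟩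
  have hC0 : 0 < C := hC ▸ Real.integral_rpowIntegrand₀₁_one_pos hs
  -- The representation `C λ^s = ∫ t^{s-2} · tλ/(λ + t) dt`, summed by Tonelli. Extended nonnegative
  -- values are used because the series for `y` is not yet known to converge.
  have hkey : ∀ z : X, ENNReal.ofReal C * ∑' n, ENNReal.ofReal (lam n ^ s * inner ℝ (φ n) z ^ 2)
      = ∫⁻ t in Ioi (0 : ℝ), ENNReal.ofReal (t ^ (s - 2) * yosidaForm φ lam t z) := by
    intro z
    have h1 : ∀ n, ENNReal.ofReal C * ENNReal.ofReal (lam n ^ s * inner ℝ (φ n) z ^ 2)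
        = ∫⁻ t in Ioi (0 : ℝ), ENNReal.ofReal (Real.rpowIntegrand₀₁ s t (lam n)
            * inner ℝ (φ n) z ^ 2) := by
      intro n
      rw [← ENNReal.ofReal_mul hC0.le, ← ofReal_integral_eq_lintegral_ofReal]
      · rw [integral_mul_const, Real.integral_rpowIntegrand₀₁_eq_rpow_mul_const hs (hlam n), ← hC]
        congr 1; ring
      · exact (Real.integrableOn_rpowIntegrand₀₁_Ioi hs (hlam n)).mul_const _
      · filter_upwards [ae_restrict_mem measurableSet_Ioi] with t ht
        have := Real.rpowIntegrand₀₁_nonneg hs0 (le_of_lt ht) (hlam n)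
        simp only [Pi.zero_apply]
        positivity
    rw [← ENNReal.tsum_mul_left]
    simp only [h1]
    rw [← lintegral_tsum fun n => ((Real.aestronglyMeasurable_rpowIntegrand₀₁ hs
      (hlam n)).aemeasurable.mul_const _).ennreal_ofReal]
    refine setLIntegral_congr_fun measurableSet_Ioi fun t ht => ?_
    have ht0 : (0 : ℝ) < t := ht
    have h2 : ∀ n, Real.rpowIntegrand₀₁ s t (lam n) * inner ℝ (φ n) z ^ 2
        = t ^ (s - 2) * (t * lam n / (lam n + t) * inner ℝ (φ n) z ^ 2) := by
      intro n
      rw [Real.rpowIntegrand₀₁_eq_pow_div hs ht0.le (hlam n)]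
      have h3 : t ^ (s - 1) = t ^ (s - 2) * t := by
        rw [← Real.rpow_add_one ht0.ne']; congr 1; ring
      rw [h3, add_comm t]
      ring
    rw [yosidaForm, ← tsum_mul_left, ENNReal.ofReal_tsum_of_nonneg]
    · simp only [h2]
    · intro n
      have := hlam n
      positivity
    · exact (h.summable_yosida ht0 z).mul_left _
  have hle : ∑' n, ENNReal.ofReal (lam n ^ s * inner ℝ (φ n) y ^ 2)
      ≤ ∑' n, ENNReal.ofReal (lam n ^ s * inner ℝ (φ n) x ^ 2) := by
    rw [← ENNReal.mul_le_mul_iff_right (a := ENNReal.ofReal C) (by simpa using hC0)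
      ENNReal.ofReal_ne_top, hkey, hkey]
    refine setLIntegral_mono' measurableSet_Ioi fun t ht => ENNReal.ofReal_le_ofReal ?_
    have ht0 : (0 : ℝ) < t := ht
    exact mul_le_mul_of_nonneg_left (hxy t ht0) (by positivity)
  have hnn : ∀ z : X, ∀ n, 0 ≤ lam n ^ s * inner ℝ (φ n) z ^ 2 := fun z n => by
    have := hlam n
    positivity
  rw [← ENNReal.ofReal_tsum_of_nonneg (hnn x) hx] at hle
  have hy : Summable fun n => lam n ^ s * inner ℝ (φ n) y ^ 2 := by
    have := ENNReal.summable_toReal (hle.trans_lt ENNReal.ofReal_lt_top).ne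
    simpa only [ENNReal.toReal_ofReal (hnn y _)] using this
  rw [← ENNReal.ofReal_tsum_of_nonneg (hnn y) hy] at hle
  exact ⟨hy, (ENNReal.ofReal_le_ofReal_iff (tsum_nonneg (hnn x))).1 hle⟩

end Hilbert

/-! ### Quadratic expansions of weighted square sums. -/

theorem tsum_mul_add_sq {l m v : ℕ → ℝ} (hl : ∀ n, 0 ≤ l n) (hm : Summable fun n => l n * m n ^ 2)
    (hv : Summable fun n => l n * v n ^ 2) (τ : ℝ) :
    (Summable fun n => l n * (m n + τ * v n) ^ 2) ∧
      ∑' n, l n * (m n + τ * v n) ^ 2 =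
        ∑' n, l n * m n ^ 2 + 2 * τ * ∑' n, l n * m n * v n + τ ^ 2 * ∑' n, l n * v n ^ 2 := by
  have hmv : Summable fun n => l n * m n * v n := by
    refine Summable.of_norm_bounded (hm.add hv) fun n => ?_
    rw [Real.norm_eq_abs, abs_le]
    have h1 := mul_nonneg (hl n) (sq_nonneg (m n + v n))
    have h2 := mul_nonneg (hl n) (sq_nonneg (m n - v n))
    have h3 := mul_nonneg (hl n) (sq_nonneg (m n))
    have h4 := mul_nonneg (hl n) (sq_nonneg (v n))
    constructor <;> nlinarith
  have h := (hm.hasSum.add (hmv.hasSum.mul_left (2 * τ))).add (hv.hasSum.mul_left (τ ^ 2))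
  have h' : HasSum (fun n => l n * (m n + τ * v n) ^ 2) _ := h.congr_fun fun n => by ring
  exact ⟨h'.summable, h'.tsum_eq⟩

/-- If a quadratic form does not decrease from `m` in the direction `v`, then moving from `m + v`
towards `m` decreases it quadratically. -/
theorem tsum_sub_sq_le {l m v : ℕ → ℝ} (hl : ∀ n, 0 ≤ l n) (hm : Summable fun n => l n * m n ^ 2)
    (hv : Summable fun n => l n * v n ^ 2)
    (hmin : ∀ τ, 0 < τ → ∑' n, l n * m n ^ 2 ≤ ∑' n, l n * (m n + τ * v n) ^ 2) {t : ℝ}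
    (ht : 0 ≤ t) :
    ∑' n, l n * (m n + (1 - t) * v n) ^ 2 ≤ ∑' n, l n * (m n + v n) ^ 2
      - 2 * t * ∑' n, l n * v n ^ 2 + t ^ 2 * ∑' n, l n * v n ^ 2 := by
  obtain ⟨b, hb⟩ : ∃ b, b = ∑' n, l n * m n * v n := ⟨_, rfl⟩
  obtain ⟨q, hq⟩ : ∃ q, q = ∑' n, l n * v n ^ 2 := ⟨_, rfl⟩
  have hq0 : 0 ≤ q := hq ▸ tsum_nonneg fun n => mul_nonneg (hl n) (sq_nonneg _)
  -- First-order optimality of `m` in the direction `v`. If `b < 0`, the step `τ = -b/(q + 1)` would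
  -- lower the form; the `+ 1` covers `q = 0`.
  have hb0 : 0 ≤ b := by
    by_contra! hneg
    have hτ : 0 < -b / (q + 1) := div_pos (by linarith) (by linarith)
    have h1 := hmin _ hτ
    rw [(tsum_mul_add_sq hl hm hv _).2, ← hb, ← hq] at h1
    have h2 : 0 ≤ (-b / (q + 1)) * (2 * b + (-b / (q + 1)) * q) := by nlinarith
    have h3 := nonneg_of_mul_nonneg_right h2 hτ
    have h4 : (-b / (q + 1)) * (q + 1) = -b := div_mul_cancel₀ _ (by linarith)
    nlinarith
  have h1 := (tsum_mul_add_sq hl hm hv (1 - t)).2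
  have h2 := (tsum_mul_add_sq hl hm hv 1).2
  simp only [one_mul] at h2
  rw [h1, h2, ← hb, ← hq]
  nlinarith [mul_nonneg ht hb0]

end SparseFrac

namespace SparseFrac

variable {d : ℕ} {s : ℝ} {Ω : Set (E d)}

/-! ### The Dirichlet form -/

theorem gradient_add {ψ χ : E d → ℝ} (hψ : Differentiable ℝ ψ) (hχ : Differentiable ℝ χ) (x : E d) :
    gradient (fun x => ψ x + χ x) x = gradient ψ x + gradient χ x := by
  simp only [gradient]
  rw [fderiv_fun_add (hψ x) (hχ x), map_add]

theorem gradient_const_mul {ψ : E d → ℝ} (hψ : Differentiable ℝ ψ) (c : ℝ) (x : E d) :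
    gradient (fun x => c * ψ x) x = c • gradient ψ x := by
  simp only [gradient]
  rw [fderiv_const_mul (hψ x), map_smul]

theorem IsTestFunction.differentiable {ψ : E d → ℝ} (hψ : IsTestFunction Ω ψ) :
    Differentiable ℝ ψ := hψ.1.differentiable (by simp)

theorem IsTestFunction.continuous_gradient {ψ : E d → ℝ} (hψ : IsTestFunction Ω ψ) :
    Continuous (gradient ψ) :=
  (LinearIsometryEquiv.continuous _).comp (hψ.1.continuous_fderiv (by simp))

theorem IsTestFunction.memLp_gradient {ψ : E d → ℝ} (hψ : IsTestFunction Ω ψ) (μ : Measure (E d))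
    [IsFiniteMeasureOnCompacts μ] : MemLp (gradient ψ) 2 μ := by
  refine hψ.continuous_gradient.memLp_of_hasCompactSupport ?_
  exact (hψ.2.1.fderiv (𝕜 := ℝ)).comp_left (map_zero (InnerProductSpace.toDual ℝ (E d)).symm)

/-- The pairs `(ψ, ∇ψ)` for test functions `ψ`. -/
def testGraph (Ω : Set (E d)) : Submodule ℝ
    (Lp ℝ 2 (volume.restrict Ω) × Lp (E d) 2 (volume.restrict Ω)) where
  carrier := {z | ∃ ψ, IsTestFunction Ω ψ ∧ z.1 =ᵐ[volume.restrict Ω] ψ ∧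
    z.2 =ᵐ[volume.restrict Ω] gradient ψ}
  add_mem' := by
    rintro a b ⟨ψ, hψ, h1, h2⟩ ⟨χ, hχ, h3, h4⟩
    refine ⟨_, hψ.add hχ, ?_, ?_⟩
    · filter_upwards [h1, h3, Lp.coeFn_add a.1 b.1] with x e1 e2 e3
      rw [Prod.fst_add, e3, Pi.add_apply, e1, e2]
    · filter_upwards [h2, h4, Lp.coeFn_add a.2 b.2] with x e1 e2 e3
      rw [Prod.snd_add, e3, Pi.add_apply, e1, e2, gradient_add hψ.differentiable hχ.differentiable]
  zero_mem' := by
    refine ⟨_, isTestFunction_zero, Lp.coeFn_zero _ _ _, (Lp.coeFn_zero _ _ _).trans ?_⟩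
    exact ae_of_all _ fun x => by simp [gradient]
  smul_mem' := by
    rintro c a ⟨ψ, hψ, h1, h2⟩
    refine ⟨_, hψ.const_mul c, ?_, ?_⟩
    · filter_upwards [h1, Lp.coeFn_smul c a.1] with x e1 e3
      rw [Prod.smul_fst, e3, Pi.smul_apply, e1, smul_eq_mul]
    · filter_upwards [h2, Lp.coeFn_smul c a.2] with x e1 e3
      rw [Prod.smul_snd, e3, Pi.smul_apply, e1, gradient_const_mul hψ.differentiable]

theorem mem_testGraph {z : Lp ℝ 2 (volume.restrict Ω) × Lp (E d) 2 (volume.restrict Ω)} :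
    z ∈ testGraph Ω ↔ ∃ ψ, IsTestFunction Ω ψ ∧ z.1 =ᵐ[volume.restrict Ω] ψ ∧
      z.2 =ᵐ[volume.restrict Ω] gradient ψ := Iff.rfl

theorem IsTestFunction.mem_testGraph {ψ : E d → ℝ} (hψ : IsTestFunction Ω ψ) :
    ((hψ.memLp (volume.restrict Ω)).toLp ψ,
      (hψ.memLp_gradient (volume.restrict Ω)).toLp (gradient ψ)) ∈ testGraph Ω :=
  ⟨ψ, hψ, (hψ.memLp _).coeFn_toLp, (hψ.memLp_gradient _).coeFn_toLp⟩

theorem DirichletEigenbasis.exists_isEigenGraph (B : DirichletEigenbasis Ω) :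
    ∃ G : ℕ → Lp (E d) 2 (volume.restrict Ω), IsEigenGraph (testGraph Ω) B.φ B.lam G := by
  choose G hG hE using B.isEigen
  refine ⟨fun n => (hG n).2.1.toLp (G n), fun n => ?_, fun n z hz => ?_⟩
  · change _ ∈ closure (testGraph Ω : Set (Lp ℝ 2 (volume.restrict Ω) ×
      Lp (E d) 2 (volume.restrict Ω)))
    rw [EMetric.mem_closure_iff]
    intro ε hε
    obtain ⟨ψ, hψ, h1, h2⟩ := (hG n).2.2 ε hε
    refine ⟨_, hψ.mem_testGraph, ?_⟩
    rw [Prod.edist_eq, max_lt_iff, Lp.edist_def, Lp.edist_def]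
    constructor
    · refine lt_of_eq_of_lt (eLpNorm_congr_ae ?_) h1
      filter_upwards [(hψ.memLp (volume.restrict Ω)).coeFn_toLp] with x hx
      simp only [Pi.sub_apply, hx]
    · refine lt_of_eq_of_lt (eLpNorm_congr_ae ?_) h2
      filter_upwards [(hψ.memLp_gradient (volume.restrict Ω)).coeFn_toLp,
        (hG n).2.1.coeFn_toLp] with x hx hx'
      simp only [Pi.sub_apply, hx, hx']
  · obtain ⟨ψ, hψ, h1, h2⟩ := mem_testGraph.1 hz
    rw [L2.inner_def, L2.inner_def]
    calc _ = ∫ x in Ω, inner ℝ (G n x) (gradient ψ x) := by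
          refine integral_congr_ae ?_
          filter_upwards [h2, (hG n).2.1.coeFn_toLp] with x e1 e2
          rw [e1, e2]
      _ = _ := hE n ψ hψ
      _ = _ := by
          congr 1
          refine integral_congr_ae ?_
          filter_upwards [h1] with x e1
          rw [e1]
          simp [mul_comm]

theorem DirichletEigenbasis.coeff_eq (B : DirichletEigenbasis Ω)
    {x : Lp ℝ 2 (volume.restrict Ω)} {w : E d → ℝ} (h : w =ᵐ[volume.restrict Ω] x) (n : ℕ) :
    B.coeff w n = inner ℝ (B.φ n) x := by
  rw [L2.inner_def, coeff]
  refine integral_congr_ae ?_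
  filter_upwards [h] with y hy
  simp [hy]

/-! ### Truncation decreases the Yosida forms -/

theorem norm_le_norm_add_of_ae_le {μ : Measure (E d)} [IsFiniteMeasure μ] {a b : Lp ℝ 2 μ}
    {δ : ℝ} (hδ : 0 ≤ δ) (h : ∀ᵐ x ∂μ, |a x| ≤ |b x| + δ) :
    ‖a‖ ≤ ‖b‖ + δ * ‖(memLp_const (1 : ℝ) : MemLp (fun _ : E d => (1 : ℝ)) 2 μ).toLp _‖ := by
  obtain ⟨e, he⟩ : ∃ e, e = (memLp_const (1 : ℝ) : MemLp (fun _ : E d => (1 : ℝ)) 2 μ).toLp _ :=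
    ⟨_, rfl⟩
  have he1 : ∀ᵐ x ∂μ, e x = 1 := he ▸ MemLp.coeFn_toLp _
  rw [← he]
  have h1 : ‖a‖ ≤ ‖|b| + δ • e‖ := by
    refine Lp.norm_le_norm_of_ae_le ?_
    filter_upwards [h, he1, Lp.coeFn_add |b| (δ • e), Lp.coeFn_smul δ e, Lp.coeFn_abs b] with
      x e1 e2 e3 e4 e5
    rw [e3, Pi.add_apply, e4, Pi.smul_apply, e2, e5, Real.norm_eq_abs, smul_eq_mul, mul_one]
    exact e1.trans (le_abs_self _)
  refine h1.trans ((norm_add_le _ _).trans ?_)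
  rw [norm_abs_eq_norm, norm_smul, Real.norm_of_nonneg hδ]

/-- Take a nearly optimal `ψ` for `x` and use its smooth truncation as competitor for `min x k`. The
gradient does not grow, and the distance grows by at most `δ` times the norm of the constant `1`,
finite because the measure is. Then `δ → 0` and `ε → 0`. -/
theorem IsEigenGraph.yosidaForm_min_le [IsFiniteMeasure (volume.restrict Ω)]
    {φ : HilbertBasis ℕ ℝ (Lp ℝ 2 (volume.restrict Ω))} {lam : ℕ → ℝ}
    {G : ℕ → Lp (E d) 2 (volume.restrict Ω)} (h : IsEigenGraph (testGraph Ω) φ lam G) {μ : ℝ}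
    (hμ : 0 < μ) {k : ℝ} (hk : 0 ≤ k) {x m : Lp ℝ 2 (volume.restrict Ω)}
    (hm : ∀ᵐ y ∂volume.restrict Ω, m y = min (x y) k) :
    yosidaForm φ lam μ m ≤ yosidaForm φ lam μ x := by
  refine le_of_forall_pos_le_add fun ε hε => ?_
  obtain ⟨z, hz, hlt⟩ := h.exists_lt_yosidaForm_add hμ x hε
  obtain ⟨ψ, hψ, h1, h2⟩ := mem_testGraph.1 hz
  refine le_trans ?_ hlt.le
  obtain ⟨c, hc⟩ : ∃ c, c = ‖(memLp_const (1 : ℝ) :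
    MemLp (fun _ : E d => (1 : ℝ)) 2 (volume.restrict Ω)).toLp _‖ := ⟨_, rfl⟩
  have hδ : ∀ δ : ℝ, 0 < δ →
      yosidaForm φ lam μ m ≤ μ * (‖x - z.1‖ + δ * c) ^ 2 + ‖z.2‖ ^ 2 := by
    intro δ hδ
    have hχ := hψ.smoothMin_comp k hδ
    refine (h.yosidaForm_le hμ m hχ.mem_testGraph).trans ?_
    have hn1 : ‖m - (hχ.memLp (volume.restrict Ω)).toLp _‖ ≤ ‖x - z.1‖ + δ * c := by
      rw [hc]
      refine norm_le_norm_add_of_ae_le hδ.le ?_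
      filter_upwards [hm, h1, (hχ.memLp (volume.restrict Ω)).coeFn_toLp, Lp.coeFn_sub x z.1,
        Lp.coeFn_sub m ((hχ.memLp (volume.restrict Ω)).toLp _)] with y e1 e2 e3 e4 e5
      rw [e5, e4, Pi.sub_apply, Pi.sub_apply, e1, e2, e3]
      have h3 : |min (x y) k - min (ψ y) k| ≤ |x y - ψ y| := by
        simpa using abs_min_sub_min_le_max (x y) k (ψ y) k
      have h4 := abs_smoothMin_sub_min_le hk hδ.le (ψ y)
      rw [abs_sub_comm] at h4
      calc |min (x y) k - smoothMin k δ (ψ y)|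
          = |(min (x y) k - min (ψ y) k) + (min (ψ y) k - smoothMin k δ (ψ y))| := by
            congr 1; ring
        _ ≤ _ := (abs_add_le _ _).trans (add_le_add h3 h4)
    have hn2 : ‖(hχ.memLp_gradient (volume.restrict Ω)).toLp _‖ ≤ ‖z.2‖ := by
      refine Lp.norm_le_norm_of_ae_le ?_
      filter_upwards [h2, (hχ.memLp_gradient (volume.restrict Ω)).coeFn_toLp] with y e1 e2
      rw [e1, e2]
      exact norm_gradient_smoothMin_comp_le hψ.differentiable k hδ y
    simp only
    gcongr
  have hlim : Tendsto (fun δ : ℝ => μ * (‖x - z.1‖ + δ * c) ^ 2 + ‖z.2‖ ^ 2) (𝓝[>] 0)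
      (𝓝 (μ * ‖x - z.1‖ ^ 2 + ‖z.2‖ ^ 2)) := by
    have hcont : Continuous fun δ : ℝ => μ * (‖x - z.1‖ + δ * c) ^ 2 + ‖z.2‖ ^ 2 := by fun_prop
    have := hcont.tendsto 0
    simp only [zero_mul, add_zero] at this
    exact this.mono_left nhdsWithin_le_nhds
  exact ge_of_tendsto hlim (eventually_nhdsWithin_of_forall hδ)

end SparseFrac

namespace SparseFrac

variable {d : ℕ} {s : ℝ} {Ω : Set (E d)}

/-! ### Translation estimates -/

theorem sq_integral_le_integral_sq {α : Type*} [MeasurableSpace α] {μ : Measure α}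
    [IsProbabilityMeasure μ] {g : α → ℝ} (hg : MemLp g 2 μ) :
    (∫ x, g x ∂μ) ^ 2 ≤ ∫ x, g x ^ 2 ∂μ := by
  obtain ⟨c, hc⟩ : ∃ c, c = ∫ x, g x ∂μ := ⟨_, rfl⟩
  have h1 : 0 ≤ ∫ x, (g x ^ 2 - 2 * c * g x + c ^ 2) ∂μ :=
    integral_nonneg fun x => by
      have : g x ^ 2 - 2 * c * g x + c ^ 2 = (g x - c) ^ 2 := by ring
      simp only [this, Pi.zero_apply]
      positivity
  have hgi : Integrable g μ := hg.integrable one_le_two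
  have h2 : Integrable (fun x => g x ^ 2 - 2 * c * g x) μ := hg.integrable_sq.sub (hgi.const_mul _)
  rw [integral_add h2 (integrable_const _), integral_sub hg.integrable_sq (hgi.const_mul _),
    integral_const_mul, ← hc] at h1
  simp only [integral_const, probReal_univ, smul_eq_mul, one_mul] at h1
  rw [← hc]
  linarith

/-- The fundamental theorem of calculus along the segment from `x` to `x + h`, followed by Jensen
and Cauchy–Schwarz. -/
theorem IsTestFunction.sq_sub_le_lintegral {ψ : E d → ℝ} (hψ : IsTestFunction Ω ψ) (x h : E d) :
    ENNReal.ofReal ((ψ (x + h) - ψ x) ^ 2) ≤ ENNReal.ofReal (‖h‖ ^ 2) *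
      ∫⁻ θ in Ioc (0 : ℝ) 1, ENNReal.ofReal (‖gradient ψ (x + θ • h)‖ ^ 2) := by
  obtain ⟨g, hg⟩ : ∃ g : ℝ → ℝ, g = fun θ => inner ℝ (gradient ψ (x + θ • h)) h := ⟨_, rfl⟩
  have hgc : Continuous g := by
    rw [hg]
    have := hψ.continuous_gradient
    fun_prop
  have hderiv : ∀ θ : ℝ, HasDerivAt (fun θ : ℝ => ψ (x + θ • h)) (g θ) θ := by
    intro θ
    have h1 : HasDerivAt (fun θ : ℝ => x + θ • h) h θ := by
      simpa using ((hasDerivAt_id θ).smul_const h).const_add x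
    have h2 := (hψ.differentiable (x + θ • h)).hasFDerivAt.comp_hasDerivAt θ h1
    have h3 : g θ = fderiv ℝ ψ (x + θ • h) h := by rw [hg]; simp [gradient]
    rw [h3]
    exact h2
  have hint : ∫ θ in Ioc (0 : ℝ) 1, g θ = ψ (x + h) - ψ x := by
    rw [← intervalIntegral.integral_of_le zero_le_one,
      intervalIntegral.integral_eq_sub_of_hasDerivAt (fun θ _ => hderiv θ)
        (hgc.intervalIntegrable _ _)]
    simp
  have hprob : IsProbabilityMeasure (volume.restrict (Ioc (0 : ℝ) 1)) := ⟨by simp⟩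
  have hgL : MemLp g 2 (volume.restrict (Ioc (0 : ℝ) 1)) := by
    rw [memLp_two_iff_integrable_sq hgc.aestronglyMeasurable]
    exact (hgc.pow 2).integrableOn_Ioc
  rw [← hint]
  refine (ENNReal.ofReal_le_ofReal (sq_integral_le_integral_sq hgL)).trans ?_
  rw [ofReal_integral_eq_lintegral_ofReal hgL.integrable_sq (ae_of_all _ fun θ => sq_nonneg _),
    ← lintegral_const_mul' _ _ ENNReal.ofReal_ne_top]
  refine lintegral_mono fun θ => ?_
  rw [← ENNReal.ofReal_mul (sq_nonneg _)]
  refine ENNReal.ofReal_le_ofReal ?_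
  rw [hg, ← mul_pow, ← sq_abs]
  have := abs_real_inner_le_norm (gradient ψ (x + θ • h)) h
  rw [mul_comm] at this
  gcongr

theorem IsTestFunction.lintegral_translate_le {ψ : E d → ℝ} (hψ : IsTestFunction Ω ψ) (h : E d) :
    ∫⁻ x, ENNReal.ofReal ((ψ (x + h) - ψ x) ^ 2) ≤
      ENNReal.ofReal (‖h‖ ^ 2) * ∫⁻ x, ENNReal.ofReal (‖gradient ψ x‖ ^ 2) := by
  refine (lintegral_mono fun x => hψ.sq_sub_le_lintegral x h).trans (le_of_eq ?_)
  rw [lintegral_const_mul' _ _ ENNReal.ofReal_ne_top]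
  congr 1
  have hm : AEMeasurable (Function.uncurry fun (x : E d) (θ : ℝ) =>
      ENNReal.ofReal (‖gradient ψ (x + θ • h)‖ ^ 2))
      ((volume : Measure (E d)).prod (volume.restrict (Ioc (0 : ℝ) 1))) := by
    have := hψ.continuous_gradient
    refine (Continuous.measurable ?_).ennreal_ofReal.aemeasurable
    fun_prop
  rw [lintegral_lintegral_swap hm]
  have h1 : ∀ θ : ℝ, ∫⁻ x, ENNReal.ofReal (‖gradient ψ (x + θ • h)‖ ^ 2)
      = ∫⁻ x, ENNReal.ofReal (‖gradient ψ x‖ ^ 2) := fun θ =>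
    lintegral_add_right_eq_self (fun x => ENNReal.ofReal (‖gradient ψ x‖ ^ 2)) (θ • h)
  simp only [h1, lintegral_const, Measure.restrict_apply MeasurableSet.univ, univ_inter,
    Real.volume_Ioc, sub_zero, ENNReal.ofReal_one, mul_one]

theorem ofReal_norm_sq_eq_lintegral {α F : Type*} [MeasurableSpace α] {μ : Measure α}
    [NormedAddCommGroup F] [InnerProductSpace ℝ F] (a : Lp F 2 μ) :
    ENNReal.ofReal (‖a‖ ^ 2) = ∫⁻ x, ENNReal.ofReal (‖a x‖ ^ 2) ∂μ := by
  rw [← ofReal_integral_eq_lintegral_ofReal ((Lp.memLp a).integrable_norm_pow two_ne_zero)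
    (ae_of_all _ fun x => by positivity), ← real_inner_self_eq_norm_sq, L2.inner_def]
  simp only [real_inner_self_eq_norm_sq]

theorem lintegral_eq_setLIntegral_of_forall_notMem {Ω : Set (E d)} (hΩ : MeasurableSet Ω)
    {g : E d → ℝ≥0∞} (hg : ∀ x ∉ Ω, g x = 0) : ∫⁻ x, g x = ∫⁻ x in Ω, g x := by
  rw [← lintegral_indicator hΩ]
  refine lintegral_congr fun x => ?_
  by_cases hx : x ∈ Ω
  · rw [indicator_of_mem hx]
  · rw [indicator_of_notMem hx, hg x hx]

/-- Split `v = (v - ψ) + ψ`: the first part costs its norm twice, the second `‖h‖ ‖∇ψ‖`. The factor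
`3` is from squaring three terms, and the bound is written as `3r²` times the Yosida functional with
`μ = 2/r²`. -/
theorem lintegral_translate_le_of_mem_testGraph (hΩ : MeasurableSet Ω)
    {x : Lp ℝ 2 (volume.restrict Ω)} {v : E d → ℝ} (hvm : Measurable v)
    (hvx : v =ᵐ[volume.restrict Ω] x) (hv0 : ∀ y ∉ Ω, v y = 0)
    {z : Lp ℝ 2 (volume.restrict Ω) × Lp (E d) 2 (volume.restrict Ω)} (hz : z ∈ testGraph Ω)
    {r : ℝ} (hr : 0 < r) {h : E d} (hh : ‖h‖ ≤ r) :
    ∫⁻ y, ENNReal.ofReal ((v (y + h) - v y) ^ 2) ≤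
      ENNReal.ofReal (3 * r ^ 2 * (2 / r ^ 2 * ‖x - z.1‖ ^ 2 + ‖z.2‖ ^ 2)) := by
  obtain ⟨ψ, hψ, h1, h2⟩ := mem_testGraph.1 hz
  have hψ0 : ∀ y ∉ Ω, ψ y = 0 := fun y hy => by
    by_contra hne
    exact hy (hψ.2.2 (subset_tsupport _ hne))
  have hg0 : ∀ y ∉ Ω, gradient ψ y = 0 := fun y hy => by
    have : fderiv ℝ ψ y = 0 := by
      by_contra hne
      exact hy (hψ.2.2 (support_fderiv_subset ℝ hne))
    simp [gradient, this]
  have hψm : Measurable ψ := hψ.1.continuous.measurable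
  obtain ⟨e, he⟩ : ∃ e : E d → ℝ, e = fun y => v y - ψ y := ⟨_, rfl⟩
  have hem : Measurable e := he ▸ hvm.sub hψm
  have hE : ∫⁻ y, ENNReal.ofReal (e y ^ 2) = ENNReal.ofReal (‖x - z.1‖ ^ 2) := by
    rw [ofReal_norm_sq_eq_lintegral, lintegral_eq_setLIntegral_of_forall_notMem hΩ
      fun y hy => by rw [he]; simp [hv0 y hy, hψ0 y hy]]
    refine lintegral_congr_ae ?_
    filter_upwards [h1, hvx, Lp.coeFn_sub x z.1] with y e1 e2 e3
    rw [e3, Pi.sub_apply, e1, ← e2, he, Real.norm_eq_abs, sq_abs]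
  have hG : ∫⁻ y, ENNReal.ofReal (‖gradient ψ y‖ ^ 2) = ENNReal.ofReal (‖z.2‖ ^ 2) := by
    rw [ofReal_norm_sq_eq_lintegral, lintegral_eq_setLIntegral_of_forall_notMem hΩ
      fun y hy => by simp [hg0 y hy]]
    refine lintegral_congr_ae ?_
    filter_upwards [h2] with y e1
    rw [e1]
  have hpt : ∀ y, ENNReal.ofReal ((v (y + h) - v y) ^ 2) ≤
      3 * (ENNReal.ofReal (e (y + h) ^ 2) + ENNReal.ofReal ((ψ (y + h) - ψ y) ^ 2)
        + ENNReal.ofReal (e y ^ 2)) := by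
    intro y
    rw [← ENNReal.ofReal_add (by positivity) (by positivity),
      ← ENNReal.ofReal_add (by positivity) (by positivity),
      ← ENNReal.ofReal_ofNat 3, ← ENNReal.ofReal_mul (by norm_num)]
    refine ENNReal.ofReal_le_ofReal ?_
    have hsplit : v (y + h) - v y = e (y + h) + (ψ (y + h) - ψ y) - e y := by rw [he]; ring
    rw [hsplit]
    nlinarith [sq_nonneg (e (y + h) - (ψ (y + h) - ψ y)), sq_nonneg (e (y + h) + e y),
      sq_nonneg ((ψ (y + h) - ψ y) + e y)]
  have hT := hψ.lintegral_translate_le h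
  rw [hG, ← ENNReal.ofReal_mul (sq_nonneg _)] at hT
  have hE' : ∫⁻ y, ENNReal.ofReal (e (y + h) ^ 2) = ENNReal.ofReal (‖x - z.1‖ ^ 2) := by
    rw [← hE]
    exact lintegral_add_right_eq_self (fun y => ENNReal.ofReal (e y ^ 2)) h
  calc _ ≤ ∫⁻ y, 3 * (ENNReal.ofReal (e (y + h) ^ 2) + ENNReal.ofReal ((ψ (y + h) - ψ y) ^ 2)
        + ENNReal.ofReal (e y ^ 2)) := lintegral_mono hpt
    _ = 3 * ((∫⁻ y, ENNReal.ofReal (e (y + h) ^ 2)) +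
        (∫⁻ y, ENNReal.ofReal ((ψ (y + h) - ψ y) ^ 2)) + ∫⁻ y, ENNReal.ofReal (e y ^ 2)) := by
      rw [lintegral_const_mul _ (by fun_prop), lintegral_add_left (by fun_prop),
        lintegral_add_left (by fun_prop)]
    _ ≤ 3 * (ENNReal.ofReal (‖x - z.1‖ ^ 2) + ENNReal.ofReal (‖h‖ ^ 2 * ‖z.2‖ ^ 2)
        + ENNReal.ofReal (‖x - z.1‖ ^ 2)) := by rw [hE', hE]; gcongr
    _ ≤ _ := by
      rw [← ENNReal.ofReal_add (by positivity) (by positivity),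
        ← ENNReal.ofReal_add (by positivity) (by positivity),
        ← ENNReal.ofReal_ofNat 3, ← ENNReal.ofReal_mul (by norm_num)]
      refine ENNReal.ofReal_le_ofReal ?_
      have h3 : ‖h‖ ^ 2 * ‖z.2‖ ^ 2 ≤ r ^ 2 * ‖z.2‖ ^ 2 := by gcongr
      have h4 : 3 * r ^ 2 * (2 / r ^ 2 * ‖x - z.1‖ ^ 2 + ‖z.2‖ ^ 2)
          = 3 * (2 * ‖x - z.1‖ ^ 2 + r ^ 2 * ‖z.2‖ ^ 2) := by field_simp
      rw [h4]
      linarith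

/-- Taking the infimum over test functions turns the bound into a Yosida form at `μ = 2/r²`, and `r²
μ^{1-s} ≤ 2 r^{2s}` gives the fractional rate. -/
theorem IsEigenGraph.lintegral_translate_le {φ : HilbertBasis ℕ ℝ (Lp ℝ 2 (volume.restrict Ω))}
    {lam : ℕ → ℝ} {G : ℕ → Lp (E d) 2 (volume.restrict Ω)}
    (hφ : IsEigenGraph (testGraph Ω) φ lam G) (hΩ : MeasurableSet Ω) (hs0 : 0 < s) (hs1 : s < 1)
    {x : Lp ℝ 2 (volume.restrict Ω)} {v : E d → ℝ} (hvm : Measurable v)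
    (hvx : v =ᵐ[volume.restrict Ω] x) (hv0 : ∀ y ∉ Ω, v y = 0)
    (hx : Summable fun n => lam n ^ s * inner ℝ (φ n) x ^ 2)
    {r : ℝ} (hr : 0 < r) {h : E d} (hh : ‖h‖ ≤ r) :
    ∫⁻ y, ENNReal.ofReal ((v (y + h) - v y) ^ 2) ≤
      ENNReal.ofReal (6 * r ^ (2 * s) * ∑' n, lam n ^ s * inner ℝ (φ n) x ^ 2) := by
  have hμ : 0 < 2 / r ^ 2 := by positivity
  have h1 : ∀ ε : ℝ, 0 < ε → ∫⁻ y, ENNReal.ofReal ((v (y + h) - v y) ^ 2) ≤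
      ENNReal.ofReal (3 * r ^ 2 * (yosidaForm φ lam (2 / r ^ 2) x + ε)) := by
    intro ε hε
    obtain ⟨z, hz, hlt⟩ := hφ.exists_lt_yosidaForm_add hμ x hε
    refine (lintegral_translate_le_of_mem_testGraph hΩ hvm hvx hv0 hz hr hh).trans ?_
    gcongr
  have h2 : ∫⁻ y, ENNReal.ofReal ((v (y + h) - v y) ^ 2) ≤
      ENNReal.ofReal (3 * r ^ 2 * yosidaForm φ lam (2 / r ^ 2) x) := by
    have hcont : Continuous fun ε : ℝ =>
        ENNReal.ofReal (3 * r ^ 2 * (yosidaForm φ lam (2 / r ^ 2) x + ε)) :=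
      ENNReal.continuous_ofReal.comp (by fun_prop)
    have hlim := (hcont.tendsto 0).mono_left (nhdsWithin_le_nhds (s := Ioi 0))
    rw [add_zero] at hlim
    exact ge_of_tendsto hlim (eventually_nhdsWithin_of_forall h1)
  refine h2.trans (ENNReal.ofReal_le_ofReal ?_)
  have h3 := hφ.yosidaForm_le_rpow hs0 hs1 hμ hx
  obtain ⟨S, hS⟩ : ∃ S, S = ∑' n, lam n ^ s * inner ℝ (φ n) x ^ 2 := ⟨_, rfl⟩
  rw [← hS] at h3 ⊢
  have hS0 : 0 ≤ S := hS ▸ tsum_nonneg fun n => by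
    have := hφ.lam_nonneg n
    positivity
  have h4 : r ^ 2 * (2 / r ^ 2) ^ (1 - s) ≤ 2 * r ^ (2 * s) := by
    have h5 : (2 : ℝ) ^ (1 - s) ≤ 2 := by
      calc (2 : ℝ) ^ (1 - s) ≤ 2 ^ (1 : ℝ) :=
            Real.rpow_le_rpow_of_exponent_le one_le_two (by linarith)
        _ = 2 := Real.rpow_one 2
    have h6 : r ^ 2 / (r ^ 2) ^ (1 - s) = r ^ (2 * s) := by
      rw [← Real.rpow_natCast, ← Real.rpow_mul hr.le, ← Real.rpow_sub hr]
      congr 1; push_cast; ring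
    rw [Real.div_rpow (by norm_num) (by positivity)]
    calc r ^ 2 * (2 ^ (1 - s) / (r ^ 2) ^ (1 - s))
        = 2 ^ (1 - s) * (r ^ 2 / (r ^ 2) ^ (1 - s)) := by ring
      _ ≤ _ := by rw [h6]; gcongr
  calc 3 * r ^ 2 * yosidaForm φ lam (2 / r ^ 2) x
      ≤ 3 * r ^ 2 * ((2 / r ^ 2) ^ (1 - s) * S) := by gcongr
    _ = 3 * (r ^ 2 * (2 / r ^ 2) ^ (1 - s)) * S := by ring
    _ ≤ 3 * (2 * r ^ (2 * s)) * S := by gcongr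
    _ = _ := by ring

/-! ### Faber–Krahn from translations. -/

/-- Averaging a translation estimate over a ball of measure `2a` controls functions supported
in a set of measure at most `a`. -/
theorem lintegral_sq_le_of_translate {v : E d → ℝ} (hvm : Measurable v) {M r a : ℝ}
    (hM : 0 ≤ M) (hr : 0 < r) (ha : 0 < a) (hra : unitBallVolume d * r ^ d = 2 * a)
    (hva : volume {y | v y ≠ 0} ≤ ENNReal.ofReal a)
    (h : ∀ h : E d, ‖h‖ ≤ r → ∫⁻ y, ENNReal.ofReal ((v (y + h) - v y) ^ 2) ≤ ENNReal.ofReal M) :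
    ∫⁻ y, ENNReal.ofReal (v y ^ 2) ≤ ENNReal.ofReal (2 * M) := by
  have hball : volume (Metric.ball (0 : E d) r) = ENNReal.ofReal (2 * a) := by
    rw [volume_ball_eq _ hr, hra]
  have hsupp : MeasurableSet {y | v y ≠ 0} := (measurableSet_eq_fun hvm measurable_const).compl
  have hup : ∫⁻ h in Metric.ball (0 : E d) r, ∫⁻ y, ENNReal.ofReal ((v (y + h) - v y) ^ 2) ≤
      ENNReal.ofReal M * ENNReal.ofReal (2 * a) := by
    rw [← hball, ← setLIntegral_const]
    exact setLIntegral_mono' measurableSet_ball fun y hy => h y (mem_ball_zero_iff.1 hy).le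
  have hm : AEMeasurable (Function.uncurry fun (h y : E d) =>
      ENNReal.ofReal ((v (y + h) - v y) ^ 2))
      ((volume.restrict (Metric.ball (0 : E d) r)).prod volume) := by
    refine Measurable.aemeasurable (Measurable.ennreal_ofReal ?_)
    have h1 : Measurable fun p : E d × E d => v (p.2 + p.1) :=
      hvm.comp (measurable_snd.add measurable_fst)
    exact (h1.sub (hvm.comp measurable_snd)).pow_const 2
  rw [lintegral_lintegral_swap hm] at hup
  -- The ball has measure `2a` and the support at most `a`, so for each `y` a set of shifts `h` of
  -- measure at least `a` satisfies `v (y + h) = 0`.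
  have hlow : ∀ y, ENNReal.ofReal (v y ^ 2) * ENNReal.ofReal a ≤
      ∫⁻ h in Metric.ball (0 : E d) r, ENNReal.ofReal ((v (y + h) - v y) ^ 2) := by
    intro y
    have hpre : MeasurableSet ((fun h => y + h) ⁻¹' {y | v y ≠ 0}) :=
      (measurable_const_add y) hsupp
    have hvol : ENNReal.ofReal a ≤
        volume (Metric.ball (0 : E d) r \ (fun h => y + h) ⁻¹' {y | v y ≠ 0}) := by
      refine le_trans ?_ le_measure_sdiff
      rw [measure_preimage_add, hball]
      refine le_trans ?_ (tsub_le_tsub_left hva _)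
      rw [two_mul, ENNReal.ofReal_add ha.le ha.le]
      simp
    calc _ ≤ ENNReal.ofReal (v y ^ 2) *
          volume (Metric.ball (0 : E d) r \ (fun h => y + h) ⁻¹' {y | v y ≠ 0}) := by gcongr
      _ = ∫⁻ h in Metric.ball (0 : E d) r \ (fun h => y + h) ⁻¹' {y | v y ≠ 0},
          ENNReal.ofReal (v y ^ 2) := by rw [setLIntegral_const]
      _ ≤ ∫⁻ h in Metric.ball (0 : E d) r \ (fun h => y + h) ⁻¹' {y | v y ≠ 0},
          ENNReal.ofReal ((v (y + h) - v y) ^ 2) := by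
        refine setLIntegral_mono' (measurableSet_ball.diff hpre) fun h hh => ?_
        have h0 : v (y + h) = 0 := by
          by_contra hne
          exact hh.2 hne
        rw [h0, zero_sub, neg_sq]
      _ ≤ _ := lintegral_mono_set sdiff_subset
  have hfin := (lintegral_mono hlow).trans hup
  rw [lintegral_mul_const' _ _ ENNReal.ofReal_ne_top, ← ENNReal.ofReal_mul hM] at hfin
  have h2 : M * (2 * a) = 2 * M * a := by ring
  rw [h2, ENNReal.ofReal_mul (by positivity)] at hfin
  exact (ENNReal.mul_le_mul_iff_left (by simpa using ha) ENNReal.ofReal_ne_top).1 hfin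

theorem IsEigenGraph.integral_sq_le {φ : HilbertBasis ℕ ℝ (Lp ℝ 2 (volume.restrict Ω))}
    {lam : ℕ → ℝ} {G : ℕ → Lp (E d) 2 (volume.restrict Ω)}
    (hφ : IsEigenGraph (testGraph Ω) φ lam G) (hd : 1 ≤ d) (hΩ : MeasurableSet Ω) (hs0 : 0 < s)
    (hs1 : s < 1) {x : Lp ℝ 2 (volume.restrict Ω)} {v : E d → ℝ} (hvm : Measurable v)
    (hvx : v =ᵐ[volume.restrict Ω] x)
    (hx : Summable fun n => lam n ^ s * inner ℝ (φ n) x ^ 2) {a : ℝ} (ha : 0 < a)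
    (hva : volume (Ω ∩ {y | v y ≠ 0}) ≤ ENNReal.ofReal a) :
    ∫ y in Ω, v y ^ 2 ≤ 12 * (2 / unitBallVolume d) ^ (2 * s / d) * a ^ (2 * s / d) *
      ∑' n, lam n ^ s * inner ℝ (φ n) x ^ 2 := by
  have hdne : d ≠ 0 := by omega
  have hω := unitBallVolume_pos d
  obtain ⟨S, hS⟩ : ∃ S, S = ∑' n, lam n ^ s * inner ℝ (φ n) x ^ 2 := ⟨_, rfl⟩
  have hS0 : 0 ≤ S := hS ▸ tsum_nonneg fun n => by
    have := hφ.lam_nonneg n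
    positivity
  obtain ⟨r, hr⟩ : ∃ r : ℝ, r = (2 * a / unitBallVolume d) ^ ((d : ℝ)⁻¹) := ⟨_, rfl⟩
  have hr0 : 0 < r := by rw [hr]; positivity
  have hrd : unitBallVolume d * r ^ d = 2 * a := by
    rw [hr, Real.rpow_inv_natCast_pow (by positivity) hdne]; field_simp
  have hrs : r ^ (2 * s) = (2 / unitBallVolume d) ^ (2 * s / d) * a ^ (2 * s / d) := by
    rw [hr, ← Real.rpow_mul (by positivity), ← Real.mul_rpow (by positivity) ha.le]
    congr 1
    · ring
    · ring
  have hind : Ω.indicator v =ᵐ[volume.restrict Ω] x := (indicator_ae_eq_restrict hΩ).trans hvx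
  have hset : {y | Ω.indicator v y ≠ 0} = Ω ∩ {y | v y ≠ 0} := by
    ext y
    by_cases hy : y ∈ Ω <;> simp [hy]
  have h1 := lintegral_sq_le_of_translate (hvm.indicator hΩ) (M := 6 * r ^ (2 * s) * S)
    (by positivity) hr0 ha hrd (by rw [hset]; exact hva) fun h hh => by
      rw [hS]
      exact hφ.lintegral_translate_le hΩ hs0 hs1 (hvm.indicator hΩ) hind
        (fun y hy => indicator_of_notMem hy v) hx hr0 hh
  rw [lintegral_eq_setLIntegral_of_forall_notMem hΩ (fun y hy => by
    rw [indicator_of_notMem hy]; simp)] at h1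
  have hvL : MemLp v 2 (volume.restrict Ω) := (Lp.memLp x).ae_eq hvx.symm
  have h2 : ∫⁻ y in Ω, ENNReal.ofReal (Ω.indicator v y ^ 2) = ENNReal.ofReal (∫ y in Ω, v y ^ 2) := by
    rw [ofReal_integral_eq_lintegral_ofReal hvL.integrable_sq (ae_of_all _ fun y => sq_nonneg _)]
    exact setLIntegral_congr_fun hΩ fun y hy => by simp only [indicator_of_mem hy]
  rw [h2, ENNReal.ofReal_le_ofReal_iff (by positivity)] at h1
  rw [← hS]
  refine h1.trans (le_of_eq ?_)
  rw [hrs]; ring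

/-! ### Truncation in the spectral space -/

/-- No pointwise inequality is available for the spectral norm. Instead, `m = min w k` is also the
truncation of `m + τ v` for every `τ > 0`, so contraction makes the form smallest at `m` along this
ray, which is the hypothesis of `tsum_sub_sq_le`. -/
theorem hasTruncation_spectral (hd : 1 ≤ d) (hs0 : 0 < s) (hs1 : s < 1) (hΩ : MeasurableSet Ω)
    [IsFiniteMeasure (volume.restrict Ω)] (B : DirichletEigenbasis Ω)
    (w : Lp ℝ 2 (volume.restrict Ω)) (hw : MemSpectral s B w) :
    (FracSpace.spectral B).HasTruncation s w := by
  obtain ⟨G, hG⟩ := B.exists_isEigenGraph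
  have hlam := hG.lam_nonneg
  have hl : ∀ n, 0 ≤ B.lam n ^ s := fun n => Real.rpow_nonneg (hlam n) s
  have hω := unitBallVolume_pos d
  have hwS : Summable fun n => B.lam n ^ s * inner ℝ (B.φ n) w ^ 2 := by
    simpa only [B.coeff_eq (ae_eq_refl (w : E d → ℝ))] using hw.2
  refine ⟨12 * (2 / unitBallVolume d) ^ (2 * s / d), 1, by positivity, one_pos, fun k hk => ?_⟩
  have hwL : MemLp w 2 (volume.restrict Ω) := Lp.memLp w
  have hvL := memLp_excess hwL hk.le
  obtain ⟨v, hvdef⟩ : ∃ v, v = hvL.toLp _ := ⟨_, rfl⟩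
  have hv : v =ᵐ[volume.restrict Ω] excess k w := hvdef ▸ hvL.coeFn_toLp
  obtain ⟨m, hmdef⟩ : ∃ m, m = w - v := ⟨_, rfl⟩
  have hm : ∀ᵐ y ∂volume.restrict Ω, m y = min (w y) k := by
    rw [hmdef]
    filter_upwards [hv, Lp.coeFn_sub w v] with y e1 e2
    rw [e2, Pi.sub_apply, e1, sub_excess]
  have hmS := (hG.rpow_sum_le hs0 hs1 (fun μ hμ => hG.yosidaForm_min_le hμ hk.le hm) hwS).1
  have hinv : ∀ n, inner ℝ (B.φ n) v = inner ℝ (B.φ n) w + (-1) * inner ℝ (B.φ n) m := fun n => by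
    rw [hmdef, inner_sub_right]; ring
  have hvS : Summable fun n => B.lam n ^ s * inner ℝ (B.φ n) v ^ 2 := by
    simp only [hinv]
    exact (tsum_mul_add_sq hl hwS hmS (-1)).1
  have hinadd : ∀ (τ : ℝ) n, inner ℝ (B.φ n) (m + τ • v)
      = inner ℝ (B.φ n) m + τ * inner ℝ (B.φ n) v := fun τ n => by
    rw [inner_add_right, inner_smul_right]
  have hmin : ∀ τ : ℝ, 0 < τ → ∑' n, B.lam n ^ s * inner ℝ (B.φ n) m ^ 2 ≤
      ∑' n, B.lam n ^ s * (inner ℝ (B.φ n) m + τ * inner ℝ (B.φ n) v) ^ 2 := by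
    intro τ hτ
    have h1 : ∀ᵐ y ∂volume.restrict Ω, m y = min ((m + τ • v) y) k := by
      filter_upwards [hm, hv, Lp.coeFn_add m (τ • v), Lp.coeFn_smul τ v] with y e1 e2 e3 e4
      rw [e3, Pi.add_apply, e4, Pi.smul_apply, e2, e1, smul_eq_mul]
      unfold excess
      rcases le_total (w y) k with h | h
      · rw [max_eq_right (by linarith), min_eq_left h, mul_zero, add_zero, min_eq_left h]
      · rw [max_eq_left (by linarith), min_eq_right h, min_eq_right]
        nlinarith
    have h2 := (hG.rpow_sum_le hs0 hs1 (x := m + τ • v)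
      (fun μ hμ => hG.yosidaForm_min_le hμ hk.le h1)
      (by simp only [hinadd]; exact (tsum_mul_add_sq hl hmS hvS τ).1)).2
    simpa only [hinadd] using h2
  refine ⟨∑' n, B.lam n ^ s * inner ℝ (B.φ n) v ^ 2,
    tsum_nonneg fun n => mul_nonneg (hl n) (sq_nonneg _), fun a ha0 _ ha => ?_,
    fun t ht0 ht1 w' hw' => ?_⟩
  · have hmeas : Measurable (excess k w) :=
      ((Lp.stronglyMeasurable w).measurable.sub_const k).max measurable_const
    exact hG.integral_sq_le hd hΩ hs0 hs1 hmeas hv.symm hvS ha0 ha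
  -- The competitor lies on the same ray, at parameter `1 - t`, while `w` is at parameter `1`.
  · have h1 : w' =ᵐ[volume.restrict Ω] (m + (1 - t) • v : Lp ℝ 2 (volume.restrict Ω)) := by
      filter_upwards [hw', hm, hv, Lp.coeFn_add m ((1 - t) • v), Lp.coeFn_smul (1 - t) v] with
        y e0 e1 e2 e3 e4
      rw [e0, e3, Pi.add_apply, e4, Pi.smul_apply, e2, e1, smul_eq_mul, ← sub_excess]
      ring
    have h2 : (fun y => w' y - w y) =ᵐ[volume.restrict Ω]
        ((-t) • v : Lp ℝ 2 (volume.restrict Ω)) := by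
      filter_upwards [hw', hv, Lp.coeFn_smul (-t) v] with y e0 e2 e4
      rw [e0, e4, Pi.smul_apply, e2, smul_eq_mul]
      ring
    refine ⟨⟨(Lp.memLp _).ae_eq h1.symm, ?_⟩, ?_, ?_⟩
    · simp only [B.coeff_eq h1, hinadd]
      exact (tsum_mul_add_sq hl hmS hvS (1 - t)).1
    · change spectralNormSq s B w' ≤ spectralNormSq s B w - _ + _
      have h3 : ∀ n, inner ℝ (B.φ n) w = inner ℝ (B.φ n) m + inner ℝ (B.φ n) v := fun n => by
        rw [hmdef, inner_sub_right]; ring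
      simp only [spectralNormSq, B.coeff_eq h1, hinadd, B.coeff_eq (ae_eq_refl (w : E d → ℝ)), h3]
      exact tsum_sub_sq_le hl hmS hvS hmin ht0
    · change spectralNormSq s B _ ≤ _
      simp only [spectralNormSq, B.coeff_eq h2, inner_smul_right]
      rw [← tsum_mul_left]
      refine le_of_eq (tsum_congr fun n => ?_)
      ring

end SparseFrac

/-! ### Assembly over the four choices of `W`. -/

theorem mainTheorem5 {d : ℕ} (hd : 1 ≤ d) {Ω : Set (SparseFrac.E d)}
    (hΩ : SparseFrac.IsBoundedLipschitzDomain Ω)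
    {T : ℝ} (hT : 0 < T) {s : ℝ} (hs0 : 0 < s) (hs1 : s < 1)
    (W : SparseFrac.FracSpace Ω)
    {p α β γ : ℝ} (hp0 : 0 < p) (hp1 : p < 1) (hα : 0 < α) (hβ : 0 < β) (hγ : 0 < γ)
    (f : SparseFrac.U T Ω → ℝ) (hf_lsc : SparseFrac.WeaklyLSC f)
    (hf_bdd : ∃ (g : SparseFrac.U T Ω →L[ℝ] ℝ) (c : ℝ), ∀ u, g u + c ≤ f u)
    (hf_diff : ContDiff ℝ 1 f)
    (hds : (d : ℝ) ≤ 2 * s ∨ (2 * s < (d : ℝ) ∧ 4 < 2 * (d : ℝ) / ((d : ℝ) - 2 * s)))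
    (u : SparseFrac.U T Ω) (w : Lp ℝ 2 (volume.restrict Ω))
    (huw : SparseFrac.IsLocalSolution T s p α β γ W f u w) :
    MemLp w ∞ (volume.restrict Ω) ∧ MemLp u ∞ (SparseFrac.cylMeasure T Ω) := by
  have hmeas : MeasurableSet Ω := hΩ.isOpen.measurableSet
  have hfin : IsFiniteMeasure (volume.restrict Ω) :=
    isFiniteMeasure_restrict.2 hΩ.isBounded.measure_lt_top.ne
  have hW : W.HasTruncation s w := by
    have hmem := huw.1.1
    cases W with
    | full => exact SparseFrac.hasTruncation_full hd hs0 hs1 hΩ hmem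
    | zero => exact SparseFrac.hasTruncation_zero hd hs0 hs1 hΩ hmem
    | tilde => exact SparseFrac.hasTruncation_tilde hd hs0 hs1 hmeas hmem
    | spectral B => exact SparseFrac.hasTruncation_spectral hd hs0 hs1 hmeas B w hmem
  exact huw.memLp_top hd (SparseFrac.lt_four_mul_of_exponent hd hds) hmeas hT hp0 hp1 hα hβ hγ
    hf_diff hW
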